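/- Let $G=(V,E)$ be a finite connected simple undirected graph with $n$ vertices and $m$ edges, let $a\ne b$ be vertices and $k\ge 1$ an integer. For a connected graph $H$ on $V$ let $c_H(v)=\sum_{u\in V}d_H(v,u)$ and $$\rho_H(a,b)=\frac{\min(c_H(a),c_H(b))}{\max(c_H(a),c_H(b))}.$$ Closeness Ratio Improvement asks for a set $S$ of at most $k$ non-edges of $G$ that maximizes $\rho_{G+S}(a,b)$, where $G+S=(V,E\cup S)$. Consider the following (nondeterministic) algorithm for instances with $c_G(b)<c_G(a)$. 1. Put $S=\emptyset$. If $ab\notin E$, put $S=\{ab\}$, and if now $c_{G+S}(a)\le c_{G+S}(b)$, return whichever of $S$ and $\emptyset$ gives the larger ratio. 2. While $|S|<k$: choose an arbitrary vertex $u\in N_{G+S}(b)\setminus N_{G+S}[a]$ and add $au$ to $S$; if now $c_{G+S}(a)\le c_{G+S}(b)$, return whichever of $S$ and $S\setminus\{au\}$ gives the larger ratio. 3. Return whichever of $S$ and $\emptyset$ gives the larger ratio. **Theorem.** On every instance with $c_G(b)<c_G(a)$ every run of the algorithm terminates, a vertex $u$ as required in step 2 always exists, and every set $S$ that can be returned is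 a $\frac{6}{11}$-approximation: it consists of at most $k$ non-edges of $G$, and $\rho_{G+S}(a,b)\ge\frac{6}{11}\,\rho_{G+T}(a,b)$ for every set $T$ of at most $k$ non-edges of $G$. Moreover, the algorithm can be implemented in time $O((n+m)\log k)$, where $\log k$ is read as $1+\lfloor\log_2 k\rfloor$: there is a fixed word-RAM program (unit-cost addition, truncated subtraction, multiplication, integer division, comparison, register access and indirect addressing; words of $w$ bits, for any $w\ge d\log_2(n+k)$ with a constant $d$) which, given $n,a,b,k$ and the adjacency lists (in any order) of any connected graph $G$ on $\{0,\dots,n-1\}$ with $a\neq b$ and $k\ge1$, halts within that time and outputs a set $S$ that is a $\frac{6}{11}$-approximation. If $c_G(b)<c_G(a)$, then $S$ is one of the sets that the algorithm can return; if $c_G(a)<c_G(b)$, the same holds with $a$ and $b$ exchanged; and if $c_G(a)=c_G(b)$, then $S=\emptyset$. -/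

import Mathlib

namespace CRI

section Problem

variable {V : Type*}

/-- The graph `G + S`: the edge set `S` is added to the graph `G`. -/
def addEdges (G : SimpleGraph V) (S : Finset (Sym2 V)) : SimpleGraph V :=
  G ⊔ SimpleGraph.fromEdgeSet (S : Set (Sym2 V))

/-- Closeness centrality: the sum of the distances from `v` to all vertices. -/
noncomputable def closeness [Fintype V] (G : SimpleGraph V) (v : V) : ℕ :=
  ∑ u : V, G.dist v u

/-- The closeness ratio of `a` and `b`. -/
noncomputable def ratio [Fintype V] (G : SimpleGraph V) (a b : V) : ℚ :=
  (min (closeness G a) (closeness G b) : ℕ) / (max (closeness G a) (closeness G b) : ℕ)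

/-- Feasible solutions: at most `k` pairs of distinct vertices, none of them an edge of `G`. -/
def Feasible (G : SimpleGraph V) (k : ℕ) (S : Finset (Sym2 V)) : Prop :=
  (∀ e ∈ S, ¬ e.IsDiag ∧ e ∉ G.edgeSet) ∧ S.card ≤ k

/-- `S` is a feasible solution of value at least `α` times the value of every feasible solution
(hence at least `α` times the optimum). -/
def IsApprox [Fintype V] (α : ℚ) (G : SimpleGraph V) (a b : V) (k : ℕ)
    (S : Finset (Sym2 V)) : Prop :=
  Feasible G k S ∧
    ∀ T, Feasible G k T → α * ratio (addEdges G T) a b ≤ ratio (addEdges G S) a b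

end Problem

section Algorithm

variable {V : Type*} [Fintype V]

/-- `R` is `S` or `T`, whichever is better (either one in case of a tie). -/
def IsBetterOf (G : SimpleGraph V) (a b : V) (S T R : Finset (Sym2 V)) : Prop :=
  (R = S ∧ ratio (addEdges G T) a b ≤ ratio (addEdges G S) a b) ∨
    (R = T ∧ ratio (addEdges G S) a b ≤ ratio (addEdges G T) a b)

/-- The stopping test: in `G + S` the centrality of `a` is at most that of `b`. -/
def Crossed (G : SimpleGraph V) (a b : V) (S : Finset (Sym2 V)) : Prop :=
  closeness (addEdges G S) a ≤ closeness (addEdges G S) b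

/-- Control states of the algorithm: before the first instruction, at the head of the while loop
with current set `S`, or after returning `S`. -/
inductive Config (V : Type*) where
  | start : Config V
  | head (S : Finset (Sym2 V)) : Config V
  | done (S : Finset (Sym2 V)) : Config V

/-- The transitions of the (nondeterministic) algorithm on the input `(G, a, b, k)`. -/
inductive Step [DecidableEq V] (G : SimpleGraph V) (a b : V) (k : ℕ) :
    Config V → Config V → Prop where
  /-- `ab` is an edge: enter the loop with `S = ∅`. -/
  | startAdj (hab : G.Adj a b) : Step G a b k .start (.head ∅)
  /-- `ab` is not an edge: put `S = {ab}`; if the test succeeds, return `S` or `∅`. -/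
  | startReturn (hab : ¬ G.Adj a b) (hc : Crossed G a b {s(a, b)}) (R : Finset (Sym2 V))
      (hR : IsBetterOf G a b {s(a, b)} ∅ R) : Step G a b k .start (.done R)
  /-- `ab` is not an edge: put `S = {ab}`; if the test fails, enter the loop. -/
  | startEnter (hab : ¬ G.Adj a b) (hc : ¬ Crossed G a b {s(a, b)}) :
      Step G a b k .start (.head {s(a, b)})
  /-- One pass through the loop: an arbitrary `u` that in `G + S` is a neighbour of `b` but is
  neither `a` nor a neighbour of `a` is chosen, and `au` is added to `S`. If the test succeeds,
  the new set or the old one is returned. -/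
  | loopReturn (S : Finset (Sym2 V)) (hS : S.card < k) (u : V) (hb : (addEdges G S).Adj b u)
      (hne : u ≠ a) (ha : ¬ (addEdges G S).Adj a u) (hc : Crossed G a b (insert s(a, u) S))
      (R : Finset (Sym2 V)) (hR : IsBetterOf G a b (insert s(a, u) S) S R) :
      Step G a b k (.head S) (.done R)
  /-- The same pass through the loop when the test fails. -/
  | loopNext (S : Finset (Sym2 V)) (hS : S.card < k) (u : V) (hb : (addEdges G S).Adj b u)
      (hne : u ≠ a) (ha : ¬ (addEdges G S).Adj a u) (hc : ¬ Crossed G a b (insert s(a, u) S)) :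
      Step G a b k (.head S) (.head (insert s(a, u) S))
  /-- The budget is used up: return `S` or `∅`. -/
  | loopExit (S : Finset (Sym2 V)) (hS : ¬ S.card < k) (R : Finset (Sym2 V))
      (hR : IsBetterOf G a b S ∅ R) : Step G a b k (.head S) (.done R)

/-- The configuration `c` occurs in some run. -/
def Reachable [DecidableEq V] (G : SimpleGraph V) (a b : V) (k : ℕ) (c : Config V) : Prop :=
  Relation.ReflTransGen (Step G a b k) .start c

/-- Some run of the algorithm returns `S`. -/
def Returns [DecidableEq V] (G : SimpleGraph V) (a b : V) (k : ℕ) (S : Finset (Sym2 V)) : Prop :=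
  Reachable G a b k (.done S)

/-- The algorithm expects that `b` has the smaller value of `closeness`. On a general instance,
`a` and `b` are named accordingly; if both values agree, nothing is added. -/
def ReturnsWlog [DecidableEq V] (G : SimpleGraph V) (a b : V) (k : ℕ)
    (S : Finset (Sym2 V)) : Prop :=
  (closeness G b < closeness G a ∧ Returns G a b k S) ∨
    (closeness G a < closeness G b ∧ Returns G b a k S) ∨
    (closeness G a = closeness G b ∧ S = ∅)

end Algorithm

/-! The machine: a word RAM with `w`-bit words and structured control. -/

/-- The binary instructions. -/
inductive Op where
  | add | sub | mul | div | lt | eq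

/-- Arithmetic on `w`-bit words; `sub` stops at `0`, `div` rounds down, tests give `1` or `0`. -/
def Op.apply (w : ℕ) : Op → ℕ → ℕ → ℕ
  | .add, x, y => (x + y) % 2 ^ w
  | .sub, x, y => x - y
  | .mul, x, y => (x * y) % 2 ^ w
  | .div, x, y => x / y
  | .lt, x, y => if x < y then 1 else 0
  | .eq, x, y => if x = y then 1 else 0

/-- Expressions: constants, registers, array cells, operations. -/
inductive Expr where
  | const (c : ℕ)
  | reg (x : ℕ)
  | get (A : ℕ) (i : Expr)
  | bin (o : Op) (e f : Expr)

/-- Programs. A program mentions finitely many registers and arrays, by fixed numbers. -/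
inductive Prog where
  | skip
  | assign (x : ℕ) (e : Expr)
  | store (A : ℕ) (i e : Expr)
  | seq (p q : Prog)
  | ite (e : Expr) (p q : Prog)
  | loop (e : Expr) (p : Prog)

/-- Contents of the registers and of the arrays. -/
@[ext] structure State where
  reg : ℕ → ℕ
  mem : ℕ → ℕ → ℕ

/-- Value of an expression. -/
def Expr.eval (w : ℕ) (s : State) : Expr → ℕ
  | .const c => c % 2 ^ w
  | .reg x => s.reg x
  | .get A i => s.mem A (i.eval w s)
  | .bin o e f => o.apply w (e.eval w s) (f.eval w s)

/-- Evaluation time: one unit per constant, register access, array access and operation. -/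
def Expr.cost : Expr → ℕ
  | .const _ => 1
  | .reg _ => 1
  | .get _ i => i.cost + 1
  | .bin _ e f => e.cost + f.cost + 1

/-- Write a register. -/
def State.setReg (s : State) (x v : ℕ) : State :=
  ⟨Function.update s.reg x v, s.mem⟩

/-- Write an array cell. -/
def State.setMem (s : State) (A i v : ℕ) : State :=
  ⟨s.reg, Function.update s.mem A (Function.update (s.mem A) i v)⟩

/-- `Exec w p s t s'`: on `w`-bit words the program `p`, started in `s`, halts in `s'` after
exactly `t` time units. Conditions are true when their value is not `0`. -/
inductive Exec (w : ℕ) : Prog → State → ℕ → State → Prop where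
  | skip (s : State) : Exec w .skip s 1 s
  | assign (x : ℕ) (e : Expr) (s : State) :
      Exec w (.assign x e) s (e.cost + 1) (s.setReg x (e.eval w s))
  | store (A : ℕ) (i e : Expr) (s : State) :
      Exec w (.store A i e) s (i.cost + e.cost + 1) (s.setMem A (i.eval w s) (e.eval w s))
  | seq {p q : Prog} {s s' s'' : State} {t t' : ℕ} (hp : Exec w p s t s')
      (hq : Exec w q s' t' s'') : Exec w (.seq p q) s (t + t') s''
  | iteTrue {e : Expr} {p q : Prog} {s s' : State} {t : ℕ} (he : e.eval w s ≠ 0)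
      (hp : Exec w p s t s') : Exec w (.ite e p q) s (e.cost + 1 + t) s'
  | iteFalse {e : Expr} {p q : Prog} {s s' : State} {t : ℕ} (he : e.eval w s = 0)
      (hq : Exec w q s t s') : Exec w (.ite e p q) s (e.cost + 1 + t) s'
  | loopFalse {e : Expr} {p : Prog} {s : State} (he : e.eval w s = 0) :
      Exec w (.loop e p) s (e.cost + 1) s
  | loopTrue {e : Expr} {p : Prog} {s s' s'' : State} {t t' : ℕ} (he : e.eval w s ≠ 0)
      (hp : Exec w p s t s') (hl : Exec w (.loop e p) s' t' s'') :
      Exec w (.loop e p) s (e.cost + 1 + t + t') s''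

/-- Adjacency lists of a graph on `{0, …, n - 1}`, in any order, one after the other in the array
`nbr`: the list of `v` occupies the cells from `off v` to `off (v + 1) - 1`. -/
structure IsAdjacencyArray {n : ℕ} (G : SimpleGraph (Fin n)) (off nbr : ℕ → ℕ) : Prop where
  off_zero : off 0 = 0
  off_le : ∀ v < n, off v ≤ off (v + 1)
  bijOn : ∀ v : Fin n,
    Set.BijOn nbr (Set.Ico (off v) (off (v + 1))) (Fin.val '' G.neighborSet v)
  off_unused : ∀ i, n < i → off i = 0
  nbr_unused : ∀ i, off n ≤ i → nbr i = 0

/-- The initial state: `n, a, b, k` in the registers `0, 1, 2, 3`, the adjacency lists in the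
arrays `0, 1`, and `0` everywhere else. -/
def inputState (n a b k : ℕ) (off nbr : ℕ → ℕ) : State where
  reg
    | 0 => n
    | 1 => a
    | 2 => b
    | 3 => k
    | _ => 0
  mem
    | 0 => off
    | 1 => nbr
    | _ => fun _ => 0

/-- Output: the size of `S` in register `0`, and the endpoints of its members, each member listed
once, in the arrays `2` and `3`. -/
def IsOutput {n : ℕ} (s : State) (S : Finset (Sym2 (Fin n))) : Prop :=
  Set.BijOn (fun i => s(s.mem 2 i, s.mem 3 i)) (Set.Iio (s.reg 0))
    (Sym2.map Fin.val '' (S : Set (Sym2 (Fin n))))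

end CRI

/-!
Write `p` and `q` for the distances from `a` and `b` in `G`. The algorithm only adds the edge `ab`
and edges from `a` to neighbours `u` of `b`. After that, the distance of `v` from `b` is
`min q (p + 1)`, whatever the vertices `u` are (`StarSet.dist_right`), and the distance from `a` is `q` if
`q < p` and some chosen `u` lies on a shortest path from `b` to `v`, and `min p (q + 1)` otherwise
(`StarSet.dist_left`). So the centrality of `b` is constant in the loop, while that of `a`
decreases. If no `u` were left, all neighbours of `b` would be `a` or neighbours of `a`, and `a`
would not have the larger centrality (`exists_candidate`).

*Approximation.* With `σ = ∑ min p q`, `x` the number of vertices closer to `a` and `y` the number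
of those closer to `b`, the centralities after adding `ab` are `σ + x` for `b` and `σ + y` for
`a`, and all estimates are linear in `σ, x, y`, the distance `D` of `a` and `b`, and the number of
loop passes:
* if `ab` alone makes the centralities cross, the ratio is `6/11` or better, as otherwise `x`
  would be so large compared to `σ` and `y` that `c(b) < c(a)` fails
  (`ratio_singleton_of_crossed`);
* a pass of the loop at most halves the centrality of `a`, so if it makes them cross, the better
  of the two ratios is at least `1/√2` (`max_ratio_of_crossed`);
* if the budget is used up and the ratio is less than `6/11`, then almost all vertices are close
  to `b`, and counting neighbours of `a` shows that no feasible set brings `a` much closer to them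
  (`ratio_of_not_crossed`).

*Running time.* Linear time is enough, without a search over the number of edges. Breadth-first
search from `b` gives each vertex `v` a key `n (d(b, v) + 1) + l`, where `l` is the least index in
the list of `b` of a neighbour on a shortest path from `b` to `v` (`BfsResult.labelled`); keys
grow by `n` along search edges, and the queue stays sorted by keys. If the candidates are joined
to `a` in the order of the list, then the formula for the distance from `a` says that joining the
`j`-th entry lowers the centrality of `a` by the number of vertices `v ≠ b` with `q < p` and label
`j` (`closeness_insert_add_drop`). These numbers are tabulated beforehand, so each pass takes
constant time. Correctness and time bounds of the program are proved together, with the rule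
`wp_loop` for loops.
-/

namespace CRI

/-! ### Distances after joining `a` to vertices around `b` -/

section Distances

variable {V : Type*}

lemma le_add_dist_of_lipschitz {H : SimpleGraph V} (hH : H.Connected) (f : V → ℕ)
    (hf : ∀ x y, H.Adj x y → f y ≤ f x + 1) (x y : V) : f y ≤ f x + H.dist x y := by
  obtain ⟨p, hp⟩ := hH.exists_walk_length_eq_dist x y
  rw [← hp]
  clear hp
  induction p with
  | nil => simp
  | cons h p ih =>
    have := hf _ _ h
    rw [SimpleGraph.Walk.length_cons]
    omega

lemma addEdges_adj {G : SimpleGraph V} {S : Finset (Sym2 V)} {x y : V} :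
    (addEdges G S).Adj x y ↔ G.Adj x y ∨ (s(x, y) ∈ S ∧ x ≠ y) := by
  simp [addEdges]

lemma le_addEdges (G : SimpleGraph V) (S : Finset (Sym2 V)) : G ≤ addEdges G S := le_sup_left

lemma addEdges_connected {G : SimpleGraph V} (hG : G.Connected) (S : Finset (Sym2 V)) :
    (addEdges G S).Connected := hG.mono (le_addEdges G S)

@[simp] lemma addEdges_empty (G : SimpleGraph V) : addEdges G ∅ = G := by
  ext x y; simp [addEdges_adj]

lemma dist_addEdges_le {G : SimpleGraph V} (hG : G.Connected) (S : Finset (Sym2 V)) (x y : V) :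
    (addEdges G S).dist x y ≤ G.dist x y :=
  SimpleGraph.Reachable.dist_anti (le_addEdges G S) (hG x y)

lemma dist_le_succ {G : SimpleGraph V} (hG : G.Connected) {x y : V} (h : G.Adj x y) (v : V) :
    G.dist v y ≤ G.dist v x + 1 := by
  have := hG.dist_triangle (u := v) (v := x) (w := y)
  rw [SimpleGraph.dist_eq_one_iff_adj.2 h] at this
  exact this

lemma sym2_mk_injective (a : V) : Function.Injective fun u : V => s(a, u) :=
  fun x y hxy => by
    rcases Sym2.eq_iff.1 hxy with h | h
    · exact h.2
    · exact h.2.trans h.1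

/-- The vertices that the loop may join to `a`. -/
def Candidate (G : SimpleGraph V) (a b u : V) : Prop :=
  G.Adj b u ∧ u ≠ a ∧ ¬ G.Adj a u

/-- `S` consists of the edge `ab`, unless it belongs to `G`, and of the edges from `a` to the
candidates in `W`. These are the sets that occur at the head of the loop. -/
structure StarSet (G : SimpleGraph V) (a b : V) (S : Finset (Sym2 V)) (W : Finset V) : Prop where
  mem_iff : ∀ e, e ∈ S ↔ (e = s(a, b) ∧ ¬ G.Adj a b) ∨ ∃ u ∈ W, e = s(a, u)
  cand : ∀ u ∈ W, Candidate G a b u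

lemma starSet_empty {G : SimpleGraph V} {a b : V} (h : G.Adj a b) : StarSet G a b ∅ ∅ :=
  ⟨by simp [h], by simp⟩

lemma starSet_singleton {G : SimpleGraph V} {a b : V} (h : ¬ G.Adj a b) :
    StarSet G a b {s(a, b)} ∅ :=
  ⟨by simp [h], by simp⟩

lemma StarSet.insert [DecidableEq V] {G : SimpleGraph V} {a b u : V} {S : Finset (Sym2 V)}
    {W : Finset V} (h : StarSet G a b S W) (hu : Candidate G a b u) :
    StarSet G a b (insert s(a, u) S) (insert u W) := by
  refine ⟨fun e => ?_, fun v hv => ?_⟩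
  · simp only [Finset.mem_insert, h.mem_iff, exists_eq_or_imp]
    tauto
  · rcases Finset.mem_insert.1 hv with rfl | hv
    · exact hu
    · exact h.cand v hv

section

variable {G : SimpleGraph V} {a b : V} {S : Finset (Sym2 V)} {W : Finset V}

lemma StarSet.adj_iff (hab : a ≠ b) (h : StarSet G a b S W) (x y : V) :
    (addEdges G S).Adj x y ↔ G.Adj x y ∨ (x = a ∧ y = b) ∨ (x = b ∧ y = a) ∨
      (x = a ∧ y ∈ W) ∨ (y = a ∧ x ∈ W) := by
  rw [addEdges_adj, h.mem_iff]
  constructor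
  · rintro (h1 | ⟨⟨h1, -⟩ | ⟨u, hu, h1⟩, hxy⟩)
    · exact .inl h1
    · rw [Sym2.eq_iff] at h1; tauto
    · rw [Sym2.eq_iff] at h1
      rcases h1 with ⟨rfl, rfl⟩ | ⟨rfl, rfl⟩ <;> tauto
  · rintro (h1 | ⟨rfl, rfl⟩ | ⟨rfl, rfl⟩ | ⟨rfl, hy⟩ | ⟨rfl, hx⟩)
    · exact .inl h1
    · by_cases hh : G.Adj x y
      · exact .inl hh
      · exact .inr ⟨.inl ⟨rfl, hh⟩, hab⟩
    · by_cases hh : G.Adj y x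
      · exact .inl hh.symm
      · exact .inr ⟨.inl ⟨Sym2.eq_swap, hh⟩, hab.symm⟩
    · exact .inr ⟨.inr ⟨y, hy, rfl⟩, (h.cand y hy).2.1.symm⟩
    · exact .inr ⟨.inr ⟨x, hx, Sym2.eq_swap⟩, (h.cand x hx).2.1⟩

lemma StarSet.adj_ab (hab : a ≠ b) (h : StarSet G a b S W) : (addEdges G S).Adj a b := by
  rw [h.adj_iff hab]; tauto

lemma StarSet.candidate_iff (hab : a ≠ b) (h : StarSet G a b S W) (u : V) :
    ((addEdges G S).Adj b u ∧ u ≠ a ∧ ¬ (addEdges G S).Adj a u) ↔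
      (Candidate G a b u ∧ u ∉ W) := by
  have hb : b ∉ W := fun hb => (h.cand b hb).1.ne rfl
  have ha : a ∉ W := fun hb => (h.cand a hb).2.1 rfl
  simp only [h.adj_iff hab, Candidate]
  constructor
  · rintro ⟨h1, h2, h3⟩
    push Not at h3
    have h4 := h3.2.2.2.1 trivial
    refine ⟨⟨?_, h2, h3.1⟩, h4⟩
    rcases h1 with h1 | h1 | h1 | h1 | h1
    · exact h1
    · exact absurd h1.1.symm hab
    · exact absurd h1.2 h2
    · exact absurd h1.1.symm hab
    · exact absurd h1.1 h2
  · rintro ⟨⟨h1, h2, h3⟩, h4⟩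
    refine ⟨.inl h1, h2, ?_⟩
    rintro (h5 | h5 | h5 | h5 | h5)
    · exact h3 h5
    · exact h1.ne h5.2.symm
    · exact hab h5.1
    · exact h4 h5.2
    · exact h2 h5.1

/-- Edges from `a` to neighbours of `b` do not shorten any path from `b`: only `ab` matters. -/
lemma StarSet.dist_right (hG : G.Connected) (hab : a ≠ b) (h : StarSet G a b S W) (v : V) :
    (addEdges G S).dist b v = min (G.dist b v) (G.dist a v + 1) := by
  have hH := addEdges_connected hG S
  apply le_antisymm
  · refine le_min (dist_addEdges_le hG S _ _) ?_
    have h1 := hH.dist_triangle (u := b) (v := a) (w := v)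
    rw [SimpleGraph.dist_eq_one_iff_adj.2 (h.adj_ab hab).symm] at h1
    have := dist_addEdges_le hG S a v
    omega
  · have hba : 0 < G.dist b a := hG.pos_dist_of_ne hab.symm
    have key := le_add_dist_of_lipschitz hH (fun v => min (G.dist b v) (G.dist a v + 1)) ?_ b v
    · simpa using key
    · intro x y hxy
      have haa : G.dist a a = 0 := by simp
      have hbb : G.dist b b = 0 := by simp
      have hW : ∀ u ∈ W, G.dist b u = 1 ∧ 0 < G.dist a u := fun u hu =>
        ⟨SimpleGraph.dist_eq_one_iff_adj.2 (h.cand u hu).1,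
          hG.pos_dist_of_ne (h.cand u hu).2.1.symm⟩
      rcases (h.adj_iff hab x y).1 hxy with h1 | ⟨rfl, rfl⟩ | ⟨rfl, rfl⟩ | ⟨rfl, hy⟩ | ⟨rfl, hx⟩
      · have := dist_le_succ hG h1 b
        have := dist_le_succ hG h1 a
        omega
      · omega
      · omega
      · have := hW y hy; omega
      · have := hW x hx; omega

open Classical in
/-- The distance from `a` to `v` after joining `a` to `b` and to the candidates in `W`. -/
noncomputable def starDist (G : SimpleGraph V) (a b : V) (W : Finset V) (v : V) : ℕ :=
  if G.dist b v < G.dist a v ∧ ∃ u ∈ W, G.dist u v + 1 = G.dist b v then G.dist b v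
  else min (G.dist a v) (G.dist b v + 1)

lemma StarSet.dist_left (hG : G.Connected) (hab : a ≠ b) (h : StarSet G a b S W) (v : V) :
    (addEdges G S).dist a v = starDist G a b W v := by
  have hH := addEdges_connected hG S
  have hle : ∀ v, starDist G a b W v ≤ min (G.dist a v) (G.dist b v + 1) := by
    intro v; unfold starDist; split_ifs <;> omega
  apply le_antisymm
  · have h0 := dist_addEdges_le hG S a v
    have h1 := hH.dist_triangle (u := a) (v := b) (w := v)
    rw [SimpleGraph.dist_eq_one_iff_adj.2 (h.adj_ab hab)] at h1
    have := dist_addEdges_le hG S b v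
    unfold starDist
    split_ifs with hc
    · obtain ⟨-, u, hu, h2⟩ := hc
      have h3 := hH.dist_triangle (u := a) (v := u) (w := v)
      rw [SimpleGraph.dist_eq_one_iff_adj.2 ((h.adj_iff hab a u).2 (by tauto))] at h3
      have := dist_addEdges_le hG S u v
      omega
    · omega
  · have hba : 0 < G.dist a b := hG.pos_dist_of_ne hab
    have haa : G.dist a a = 0 := by simp
    have hbb : G.dist b b = 0 := by simp
    have key := le_add_dist_of_lipschitz hH (starDist G a b W) ?_ a v
    · have := hle a; omega
    · intro x y hxy
      have hx := hle x
      have hy := hle y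
      rcases (h.adj_iff hab x y).1 hxy with h1 | ⟨rfl, rfl⟩ | ⟨rfl, rfl⟩ | ⟨rfl, hyW⟩ | ⟨rfl, hxW⟩
      · have hb := dist_le_succ hG h1 b
        have ha := dist_le_succ hG h1 a
        by_cases hc : G.dist b x < G.dist a x ∧ ∃ u ∈ W, G.dist u x + 1 = G.dist b x
        · have hx' : starDist G a b W x = G.dist b x := if_pos hc
          by_cases hq : G.dist b y ≤ G.dist b x
          · omega
          · obtain ⟨-, u, hu, h2⟩ := hc
            have hu1 := dist_le_succ hG h1 u
            have hu2 := hG.dist_triangle (u := b) (v := u) (w := y)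
            rw [SimpleGraph.dist_eq_one_iff_adj.2 (h.cand u hu).1] at hu2
            by_cases hp : G.dist b y < G.dist a y
            · have : starDist G a b W y = G.dist b y := if_pos ⟨hp, u, hu, by omega⟩
              omega
            · omega
        · have hx' : starDist G a b W x = min (G.dist a x) (G.dist b x + 1) := if_neg hc
          omega
      · omega
      · omega
      · have h2 : G.dist b y = 1 := SimpleGraph.dist_eq_one_iff_adj.2 (h.cand y hyW).1
        have h3 : G.dist x y ≠ 0 := (hG.pos_dist_of_ne (h.cand y hyW).2.1.symm).ne'
        have h4 : G.dist x y ≠ 1 := fun h' =>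
          (h.cand y hyW).2.2 (SimpleGraph.dist_eq_one_iff_adj.1 h')
        have : starDist G x b W y = G.dist b y := if_pos ⟨by omega, y, hyW, by simp [h2]⟩
        omega
      · have h2 : G.dist b x = 1 := SimpleGraph.dist_eq_one_iff_adj.2 (h.cand x hxW).1
        omega

lemma StarSet.subset_nonEdges (hab : a ≠ b) (h : StarSet G a b S W) :
    ∀ e ∈ S, ¬ e.IsDiag ∧ e ∉ G.edgeSet := by
  intro e he
  rcases (h.mem_iff e).1 he with ⟨rfl, h1⟩ | ⟨u, hu, rfl⟩
  · exact ⟨by simpa using hab, by simpa using h1⟩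
  · have := h.cand u hu
    exact ⟨by simpa using this.2.1.symm, by simpa using this.2.2⟩

open Classical in
lemma StarSet.card_eq (h : StarSet G a b S W) :
    S.card = (if G.Adj a b then 0 else 1) + W.card := by
  have hinj := sym2_mk_injective a
  have hb : b ∉ W := fun hb => (h.cand b hb).1.ne rfl
  have hS : S = (if G.Adj a b then ∅ else {s(a, b)}) ∪ W.image (fun u => s(a, u)) := by
    ext e
    rw [h.mem_iff]
    split_ifs with h1 <;> simp [h1, eq_comm]
  rw [hS, Finset.card_union_of_disjoint, Finset.card_image_of_injective _ hinj]
  · split_ifs <;> simp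
  · split_ifs
    · simp
    · rw [Finset.disjoint_singleton_left]
      intro hm
      obtain ⟨u, hu, h2⟩ := Finset.mem_image.1 hm
      exact hb (hinj h2 ▸ hu)

end

end Distances

/-! ### The approximation guarantee -/

section Approximation

variable {V : Type*} [Fintype V]

open Classical in
/-- The number of vertices that are closer to `a` than to `b`. -/
noncomputable def closer (G : SimpleGraph V) (a b : V) : ℕ :=
  (Finset.univ.filter fun v => G.dist a v < G.dist b v).card

/-- The sum over all vertices of the distance to the nearer of `a` and `b`. -/
noncomputable def nearSum (G : SimpleGraph V) (a b : V) : ℕ :=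
  ∑ v, min (G.dist a v) (G.dist b v)

variable {G : SimpleGraph V} {a b : V} {S : Finset (Sym2 V)} {W : Finset V}

lemma nearSum_comm : nearSum G a b = nearSum G b a := by
  simp [nearSum, min_comm]

lemma closer_pos (hG : G.Connected) (hab : a ≠ b) : 0 < closer G a b := by
  classical
  refine Finset.card_pos.2 ⟨a, ?_⟩
  simpa using hG.pos_dist_of_ne hab.symm

lemma closer_add_closer_le : closer G a b + closer G b a ≤ Fintype.card V := by
  classical
  unfold closer
  rw [← Finset.card_union_of_disjoint]
  · exact Finset.card_le_univ _
  · rw [Finset.disjoint_filter]; intro v _ h; omega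

lemma card_le_nearSum (hG : G.Connected) : Fintype.card V ≤ nearSum G a b + 2 := by
  classical
  have h : ∑ v : V, 1 ≤ ∑ v : V, (min (G.dist a v) (G.dist b v) + ((if v = a then 1 else 0)
      + (if v = b then 1 else 0))) := by
    refine Finset.sum_le_sum fun v _ => ?_
    by_cases h1 : v = a
    · simp [h1]
    by_cases h2 : v = b
    · simp [h2]
    have := hG.pos_dist_of_ne (Ne.symm h1)
    have := hG.pos_dist_of_ne (Ne.symm h2)
    omega
  simp only [Finset.sum_add_distrib, Finset.sum_ite_eq', Finset.mem_univ, if_true] at h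
  simpa [nearSum] using h

lemma StarSet.closeness_right (hG : G.Connected) (hab : a ≠ b) (h : StarSet G a b S W) :
    closeness (addEdges G S) b = nearSum G a b + closer G a b := by
  classical
  unfold closeness nearSum closer
  rw [Finset.card_filter, ← Finset.sum_add_distrib]
  refine Finset.sum_congr rfl fun v _ => ?_
  rw [h.dist_right hG hab]
  split_ifs <;> omega

lemma StarSet.closeness_left (hG : G.Connected) (hab : a ≠ b) (h : StarSet G a b S W) :
    closeness (addEdges G S) a = ∑ v, starDist G a b W v :=
  Finset.sum_congr rfl fun v _ => h.dist_left hG hab v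

omit [Fintype V] in
lemma Candidate.two_le_dist (hG : G.Connected) {u : V} (h : Candidate G a b u) :
    2 ≤ G.dist a u := by
  have h3 : G.dist a u ≠ 0 := (hG.pos_dist_of_ne h.2.1.symm).ne'
  have h4 : G.dist a u ≠ 1 := fun h' => h.2.2 (SimpleGraph.dist_eq_one_iff_adj.1 h')
  omega

omit [Fintype V] in
lemma Candidate.dist_eq_one {u : V} (h : Candidate G a b u) : G.dist b u = 1 :=
  SimpleGraph.dist_eq_one_iff_adj.2 h.1

/-- Every candidate joined to `a` gets closer to `a`. -/
lemma StarSet.closeness_left_add_card_le (hG : G.Connected) (hab : a ≠ b)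
    (h : StarSet G a b S W) :
    closeness (addEdges G S) a + W.card ≤ nearSum G a b + closer G b a := by
  classical
  have hW : W.card = ∑ v, if v ∈ W then 1 else 0 := by simp
  rw [h.closeness_left hG hab, hW]
  unfold nearSum closer
  rw [Finset.card_filter, ← Finset.sum_add_distrib, ← Finset.sum_add_distrib]
  refine Finset.sum_le_sum fun v _ => ?_
  by_cases hv : v ∈ W
  · have h2 := (h.cand v hv).two_le_dist hG
    have h1 := (h.cand v hv).dist_eq_one
    have : starDist G a b W v = G.dist b v := if_pos ⟨by omega, v, hv, by simp [h1]⟩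
    rw [this]
    split_ifs <;> omega
  · unfold starDist
    split_ifs <;> omega

lemma StarSet.closeness_left_empty (hG : G.Connected) (hab : a ≠ b) (h : StarSet G a b S ∅) :
    closeness (addEdges G S) a = nearSum G a b + closer G b a := by
  classical
  rw [h.closeness_left hG hab]
  unfold nearSum closer
  rw [Finset.card_filter, ← Finset.sum_add_distrib]
  refine Finset.sum_congr rfl fun v _ => ?_
  simp only [starDist, Finset.notMem_empty, false_and, exists_false, and_false, if_false]
  split_ifs <;> omega

/-- A walk from `b` to a vertex closer to `a` may lead through `a`. -/
lemma closeness_le_nearSum_add (hG : G.Connected) (T : Finset (Sym2 V)) :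
    closeness (addEdges G T) b ≤ nearSum G a b + (addEdges G T).dist a b * closer G a b := by
  classical
  unfold closeness nearSum closer
  rw [Finset.card_filter, Finset.mul_sum, ← Finset.sum_add_distrib]
  refine Finset.sum_le_sum fun v _ => ?_
  have h1 := (addEdges_connected hG T).dist_triangle (u := b) (v := a) (w := v)
  rw [SimpleGraph.dist_comm (u := b) (v := a)] at h1
  have h2 := dist_addEdges_le hG T a v
  have h3 := dist_addEdges_le hG T b v
  split_ifs <;> omega

lemma dist_mul_closer_le (hG : G.Connected) (T : Finset (Sym2 V)) :
    (addEdges G T).dist a b * closer G a b ≤ closeness (addEdges G T) b + nearSum G a b := by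
  classical
  unfold closeness nearSum closer
  rw [Finset.card_filter, Finset.mul_sum, ← Finset.sum_add_distrib]
  refine Finset.sum_le_sum fun v _ => ?_
  have h1 := (addEdges_connected hG T).dist_triangle (u := a) (v := v) (w := b)
  rw [SimpleGraph.dist_comm (u := v) (v := b)] at h1
  have h2 := dist_addEdges_le hG T a v
  split_ifs <;> omega

lemma nearSum_add_closer_le : nearSum G a b + closer G a b ≤ closeness G b := by
  classical
  unfold closeness nearSum closer
  rw [Finset.card_filter, ← Finset.sum_add_distrib]
  refine Finset.sum_le_sum fun v _ => ?_
  split_ifs <;> omega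

open Classical in
/-- All vertices except `a` and its neighbours have distance at least two from `a`; the number of
neighbours grows by at most one with every added edge. -/
lemma two_mul_card_le (hG : G.Connected) (hab : a ≠ b) (T : Finset (Sym2 V)) {j : ℕ}
    (hj : T.card ≤ (if G.Adj a b then 0 else 1) + j) :
    2 * Fintype.card V + closer G b a ≤ closeness (addEdges G T) a + Fintype.card V + j + 2 := by
  have hinj := sym2_mk_injective a
  have hM : (Finset.univ.filter fun v => s(a, v) ∈ T).card ≤ T.card :=
    Finset.card_le_card_of_injOn (fun u : V => s(a, u)) (by intro v; simp) hinj.injOn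
  have h1 : ∑ v : V, 2 ≤ ∑ v : V, ((addEdges G T).dist a v +
      ((if (addEdges G T).Adj a v then 1 else 0) + (if v = a then 2 else 0))) := by
    refine Finset.sum_le_sum fun v _ => ?_
    by_cases hv : v = a
    · simp [hv]
    have h2 := (addEdges_connected hG T).pos_dist_of_ne (Ne.symm hv)
    by_cases h3 : (addEdges G T).Adj a v
    · simp only [h3, if_true]; omega
    · have h4 : (addEdges G T).dist a v ≠ 1 := fun h' =>
        h3 (SimpleGraph.dist_eq_one_iff_adj.1 h')
      omega
  have h2 : ∑ v : V, ((if (addEdges G T).Adj a v then 1 else 0) +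
      ((if G.dist b v < G.dist a v then 1 else 0) + (if v = a then 1 else 0))) ≤
      ∑ v : V, (1 + ((if s(a, v) ∈ T then 1 else 0) +
        (if v = b then (if G.Adj a b then 1 else 0) else 0))) := by
    refine Finset.sum_le_sum fun v _ => ?_
    by_cases hv : v = a
    · subst hv; simp
    by_cases hvb : v = b
    · subst hvb
      simp only [addEdges_adj, hv, if_false, if_true]
      by_cases h3 : s(a, v) ∈ T <;> by_cases h4 : G.Adj a v <;> simp [h3, h4] <;>
        split_ifs <;> omega
    · simp only [addEdges_adj, hv, hvb, if_false]
      have h5 := hG.pos_dist_of_ne (Ne.symm hvb)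
      by_cases h4 : G.Adj a v
      · have h6 := SimpleGraph.dist_eq_one_iff_adj.2 h4
        simp only [h4, true_or, if_true]
        split_ifs <;> omega
      · by_cases h3 : s(a, v) ∈ T <;> simp [h3, h4] <;> split_ifs <;> omega
  simp only [Finset.sum_add_distrib, Finset.sum_ite_eq', Finset.mem_univ, if_true,
    Finset.sum_const, Finset.card_univ, smul_eq_mul, ← Finset.card_filter, mul_one] at h1 h2
  unfold closeness closer
  split_ifs at hj h2 <;> omega

lemma closeness_pos (hG : G.Connected) (hab : a ≠ b) : 0 < closeness G a :=
  Finset.sum_pos' (fun _ _ => Nat.zero_le _) ⟨b, Finset.mem_univ _, hG.pos_dist_of_ne hab⟩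

omit [Fintype V] in
lemma feasible_empty (k : ℕ) : Feasible G k ∅ := ⟨by simp, by simp⟩

lemma ratio_nonneg : 0 ≤ ratio G a b := by unfold ratio; positivity

lemma ratio_comm : ratio G a b = ratio G b a := by simp [ratio, min_comm, max_comm]

lemma ratio_le_one : ratio G a b ≤ 1 := by
  unfold ratio
  apply div_le_one_of_le₀ _ (by positivity)
  exact_mod_cast min_le_max

lemma ratio_of_le (h : closeness G b ≤ closeness G a) :
    ratio G a b = closeness G b / closeness G a := by
  simp [ratio, h]

lemma ratio_le_div (hG : G.Connected) (hab : a ≠ b) :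
    ratio G a b ≤ closeness G b / closeness G a := by
  have h : 0 < closeness G a := closeness_pos hG hab
  unfold ratio
  gcongr
  · exact min_le_right _ _
  · exact le_max_left _ _

lemma IsApprox.symm {k : ℕ} {α : ℚ} (h : IsApprox α G a b k S) : IsApprox α G b a k S :=
  ⟨h.1, fun T hT => by
    rw [ratio_comm (a := b), ratio_comm (a := b)]; exact h.2 T hT⟩

lemma IsBetterOf.isApprox {k : ℕ} {α : ℚ} {T R : Finset (Sym2 V)} (h : IsBetterOf G a b S T R)
    (hS : Feasible G k S) (hT : Feasible G k T)
    (hα : ∀ T', Feasible G k T' → α * ratio (addEdges G T') a b ≤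
      max (ratio (addEdges G S) a b) (ratio (addEdges G T) a b)) : IsApprox α G a b k R := by
  rcases h with ⟨rfl, h⟩ | ⟨rfl, h⟩
  · exact ⟨hS, fun T' hT' => (hα T' hT').trans (max_le le_rfl h)⟩
  · exact ⟨hT, fun T' hT' => (hα T' hT').trans (max_le h le_rfl)⟩

lemma exists_isBetterOf (S T : Finset (Sym2 V)) : ∃ R, IsBetterOf G a b S T R := by
  rcases le_total (ratio (addEdges G T) a b) (ratio (addEdges G S) a b) with h | h
  · exact ⟨S, .inl ⟨rfl, h⟩⟩
  · exact ⟨T, .inr ⟨rfl, h⟩⟩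

/-- If the edge `ab` alone makes the centralities cross, the resulting ratio is at least `6/11`:
otherwise almost all vertices would be close to `a`, and then `a` would have had the smaller
centrality from the beginning. -/
lemma ratio_singleton_of_crossed (hG : G.Connected) (hab : a ≠ b)
    (hc : closeness G b < closeness G a) (hn : ¬ G.Adj a b) (hx : Crossed G a b {s(a, b)}) :
    6 / 11 ≤ ratio (addEdges G {s(a, b)}) a b := by
  have hst := starSet_singleton (G := G) hn
  have e1 := hst.closeness_right hG hab
  have e2 := hst.closeness_left_empty hG hab
  have hpos := closeness_pos (addEdges_connected hG {s(a, b)}) hab.symm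
  rw [ratio_comm, ratio_of_le hx, le_div_iff₀ (by exact_mod_cast hpos)]
  suffices h : 6 * closeness (addEdges G {s(a, b)}) b ≤
      11 * closeness (addEdges G {s(a, b)}) a by
    have : (6 : ℚ) * closeness (addEdges G {s(a, b)}) b ≤
      11 * closeness (addEdges G {s(a, b)}) a := by exact_mod_cast h
    linarith
  rw [e1, e2]
  have hD0 : G.dist a b ≠ 0 := (hG.pos_dist_of_ne hab).ne'
  have hD1 : G.dist a b ≠ 1 := fun h' => hn (SimpleGraph.dist_eq_one_iff_adj.1 h')
  have f1 := closeness_le_nearSum_add (a := b) (b := a) hG ∅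
  have f2 := dist_mul_closer_le (a := a) (b := b) hG ∅
  have f3 := nearSum_add_closer_le (G := G) (a := a) (b := b)
  have f4 := card_le_nearSum (a := a) (b := b) hG
  have f5 := closer_add_closer_le (G := G) (a := a) (b := b)
  have f6 := closer_pos (G := G) hG hab
  have f7 := closer_pos (G := G) hG hab.symm
  rw [addEdges_empty] at f1 f2
  rw [SimpleGraph.dist_comm, nearSum_comm] at f1
  generalize closer G a b = x at *
  generalize closer G b a = y at *
  generalize nearSum G a b = σ at *
  by_contra! hlt
  rcases Nat.lt_or_ge 2 (G.dist a b) with hD | hD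
  · have hxy : y ≤ x := by omega
    -- `D (x - y) < 2 σ`, while `5 σ + 11 y < 6 x`
    have : 3 * (x - y) ≤ G.dist a b * (x - y) := Nat.mul_le_mul_right _ hD
    simp only [Nat.mul_sub] at this
    omega
  · generalize G.dist a b = D at *
    obtain rfl : D = 2 := by omega
    omega

/-- If joining one more candidate makes the centralities cross, then the better of the two sets has
ratio at least `6/11`: the centrality of `a` drops by a factor of at most `2` in one pass. -/
lemma max_ratio_of_crossed [DecidableEq V] (hG : G.Connected) (hab : a ≠ b)
    (h : StarSet G a b S W) {u : V}
    (hu : Candidate G a b u) (hc : ¬ Crossed G a b S) (hc' : Crossed G a b (insert s(a, u) S)) :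
    6 / 11 ≤ max (ratio (addEdges G (insert s(a, u) S)) a b) (ratio (addEdges G S) a b) := by
  have h' := h.insert hu
  have hle : closeness (addEdges G S) a ≤ 2 * closeness (addEdges G (insert s(a, u) S)) a := by
    rw [h.closeness_left hG hab, h'.closeness_left hG hab, Finset.mul_sum]
    refine Finset.sum_le_sum fun v _ => ?_
    by_cases hva : v = a
    · subst hva
      simp [starDist]
    by_cases hvb : v = b
    · subst hvb
      simp only [starDist, SimpleGraph.dist_self, Nat.add_eq_zero_iff, one_ne_zero, and_false]
      omega
    have := hG.pos_dist_of_ne (Ne.symm hva)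
    have := hG.pos_dist_of_ne (Ne.symm hvb)
    unfold starDist
    split_ifs <;> omega
  have hB : closeness (addEdges G S) b = closeness (addEdges G (insert s(a, u) S)) b := by
    rw [h.closeness_right hG hab, h'.closeness_right hG hab]
  unfold Crossed at hc hc'
  have hp1 := closeness_pos (addEdges_connected hG S) hab
  have hp2 := closeness_pos (addEdges_connected hG S) hab.symm
  rw [ratio_comm, ratio_of_le hc', ratio_of_le (by omega), ← hB]
  rw [← hB] at hc'
  generalize closeness (addEdges G S) a = A at *
  generalize closeness (addEdges G (insert s(a, u) S)) a = A' at *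
  generalize closeness (addEdges G S) b = B at *
  by_contra! hlt
  rw [max_lt_iff, div_lt_iff₀ (by positivity), div_lt_iff₀ (by positivity)] at hlt
  have : (A : ℚ) ≤ 2 * A' := by exact_mod_cast hle
  have : (0 : ℚ) < A := by exact_mod_cast hp1
  linarith [hlt.1, hlt.2]

/-- If the budget is used up, then either the ratio is at least `6/11`, or almost all vertices are
close to `b`; in the second case, every other feasible set leaves `a` so far away that its ratio
is at most `11/12`, whereas that of `S` is at least `1/2`. -/
lemma ratio_of_not_crossed (hG : G.Connected) (hab : a ≠ b) (h : StarSet G a b S W)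
    (hc : ¬ Crossed G a b S) {k : ℕ} (hk : k ≤ S.card) {T : Finset (Sym2 V)}
    (hT : Feasible G k T) :
    6 / 11 * ratio (addEdges G T) a b ≤ ratio (addEdges G S) a b := by
  classical
  unfold Crossed at hc
  have hH := addEdges_connected hG S
  have hHT := addEdges_connected hG T
  have hp1 := closeness_pos hH hab
  have hp3 := closeness_pos hHT hab
  have hle : ratio (addEdges G T) a b * closeness (addEdges G T) a ≤
      closeness (addEdges G T) b :=
    (le_div_iff₀ (by exact_mod_cast hp3)).1 (ratio_le_div hHT hab)
  have h1 := ratio_le_one (G := addEdges G T) (a := a) (b := b)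
  have h0 := ratio_nonneg (G := addEdges G T) (a := a) (b := b)
  rw [ratio_of_le (G := addEdges G S) (not_le.1 hc).le, le_div_iff₀ (by exact_mod_cast hp1)]
  have e1 := h.closeness_right hG hab
  have e2 := h.closeness_left_add_card_le hG hab
  have hcard := h.card_eq
  have g1 := two_mul_card_le hG hab T (j := W.card) (hT.2.trans (hk.trans hcard.le))
  have f1 := closeness_le_nearSum_add (a := a) (b := b) hG T
  have f2 := dist_mul_closer_le (a := b) (b := a) hG T
  rw [SimpleGraph.dist_comm, nearSum_comm] at f2
  have f4 := card_le_nearSum (a := a) (b := b) hG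
  have f5 := closer_add_closer_le (G := G) (a := a) (b := b)
  have f6 := closer_pos (G := G) hG hab
  generalize closer G a b = x at *
  generalize closer G b a = y at *
  generalize nearSum G a b = σ at *
  generalize Fintype.card V = n at *
  generalize W.card = j at *
  generalize (addEdges G T).dist a b = D at *
  generalize closeness (addEdges G S) a = A at *
  generalize closeness (addEdges G S) b = B at *
  generalize closeness (addEdges G T) a = A' at *
  generalize closeness (addEdges G T) b = B' at *
  generalize ratio (addEdges G T) a b = r at *
  by_contra! hlt
  have hApos : (0 : ℚ) < A := by exact_mod_cast hp1
  have k1 : 11 * B < 6 * A := by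
    have : (11 : ℚ) * B < 6 * A := by nlinarith
    exact_mod_cast this
  have k2 : A ≤ 2 * B := by omega
  have k3 : 11 * A' < 12 * B' := by
    have q1 : (A : ℚ) ≤ 2 * B := by exact_mod_cast k2
    have q2 : (0 : ℚ) < B := by linarith
    have q3 : (0 : ℚ) < A' := by exact_mod_cast hp3
    -- `11 B < 6 r A ≤ 12 r B`, hence `11 < 12 r`, and `r A' ≤ B'`
    have q4 : 11 < 12 * r := by
      by_contra! hr
      nlinarith
    have : (11 : ℚ) * A' < 12 * B' := by nlinarith
    exact_mod_cast this
  subst e1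
  -- for `D ≥ 3` compare `c_T(a) ≥ D y - σ` with `c_T(b) ≤ σ + D x`; for `D ≤ 2` use the number of
  -- neighbours of `a` in `G + T`
  rcases Nat.lt_or_ge 2 D with hD | hD
  · have k4 : x ≤ y := by omega
    have : 3 * (11 * y - 12 * x) ≤ D * (11 * y - 12 * x) := Nat.mul_le_mul_right _ hD
    rw [Nat.mul_sub, Nat.mul_sub, Nat.mul_left_comm D, Nat.mul_left_comm D] at this
    omega
  · have : D * x ≤ 2 * x := Nat.mul_le_mul_right _ hD
    omega

end Approximation

section Runs

variable {V : Type*} [Fintype V] [DecidableEq V] {G : SimpleGraph V} {a b : V} {k : ℕ}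

/-- Invariant of the runs: at the head of the loop the current set joins `a` to `b` and to some
neighbours of `b`, it is within the budget and has not made the centralities cross; what is returned
is an approximation. -/
def GoodConfig (G : SimpleGraph V) (a b : V) (k : ℕ) : Config V → Prop
  | .start => True
  | .head S => (∃ W, StarSet G a b S W) ∧ ¬ Crossed G a b S ∧ S.card ≤ k
  | .done S => IsApprox (6 / 11) G a b k S

omit [Fintype V] [DecidableEq V] in
lemma StarSet.notMem_of_not_adj {S : Finset (Sym2 V)} {W : Finset V} (hab : a ≠ b)
    (h : StarSet G a b S W) {u : V} (hb : (addEdges G S).Adj b u)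
    (hne : u ≠ a) (ha : ¬ (addEdges G S).Adj a u) :
    Candidate G a b u ∧ s(a, u) ∉ S := by
  refine ⟨((h.candidate_iff hab u).1 ⟨hb, hne, ha⟩).1, fun hm => ha ?_⟩
  exact addEdges_adj.2 (.inr ⟨hm, hne.symm⟩)

lemma GoodConfig.step (hG : G.Connected) (hk : 1 ≤ k) (hc : closeness G b < closeness G a)
    {c c' : Config V} (h : GoodConfig G a b k c) (hs : Step G a b k c c') :
    GoodConfig G a b k c' := by
  have hab : a ≠ b := by rintro rfl; exact hc.ne rfl
  have hle : ∀ {x : ℚ} (T : Finset (Sym2 V)), 6 / 11 ≤ x →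
      6 / 11 * ratio (addEdges G T) a b ≤ x := by
    intro x T hx
    have := ratio_le_one (G := addEdges G T) (a := a) (b := b)
    linarith
  cases hs with
  | startAdj hadj => exact ⟨⟨∅, starSet_empty hadj⟩, by simpa [Crossed] using hc, by simp⟩
  | startReturn hadj hcr R hR =>
    refine hR.isApprox ⟨(starSet_singleton hadj).subset_nonEdges hab, by simpa using hk⟩
      (feasible_empty k) fun T hT => hle T (le_max_of_le_left ?_)
    exact ratio_singleton_of_crossed hG hab hc hadj hcr
  | startEnter hadj hcr => exact ⟨⟨∅, starSet_singleton hadj⟩, hcr, by simpa using hk⟩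
  | loopReturn S hS u hb hne ha hcr R hR =>
    obtain ⟨⟨W, hW⟩, hnc, -⟩ := h
    obtain ⟨hu, hm⟩ := hW.notMem_of_not_adj hab hb hne ha
    refine hR.isApprox ⟨(hW.insert hu).subset_nonEdges hab, ?_⟩
      ⟨hW.subset_nonEdges hab, hS.le⟩ fun T hT => hle T ?_
    · rw [Finset.card_insert_of_notMem hm]; exact hS
    · exact max_ratio_of_crossed hG hab hW hu hnc hcr
  | loopNext S hS u hb hne ha hcr =>
    obtain ⟨⟨W, hW⟩, hnc, -⟩ := h
    obtain ⟨hu, hm⟩ := hW.notMem_of_not_adj hab hb hne ha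
    exact ⟨⟨_, hW.insert hu⟩, hcr, by rw [Finset.card_insert_of_notMem hm]; exact hS⟩
  | loopExit S hS R hR =>
    obtain ⟨⟨W, hW⟩, hnc, hcard⟩ := h
    exact hR.isApprox ⟨hW.subset_nonEdges hab, hcard⟩ (feasible_empty k) fun T hT =>
      le_max_of_le_left (ratio_of_not_crossed hG hab hW hnc (not_lt.1 hS) hT)

lemma Reachable.goodConfig (hG : G.Connected) (hk : 1 ≤ k) (hc : closeness G b < closeness G a)
    {c : Config V} (h : Reachable G a b k c) : GoodConfig G a b k c := by
  induction h with
  | refl => trivial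
  | tail _ hs ih => exact ih.step hG hk hc hs

/-- As long as `a` has the larger centrality, some neighbour of `b` is neither `a` nor
adjacent to `a`. -/
lemma exists_candidate {H : SimpleGraph V} (hH : H.Connected) (hc : closeness H b < closeness H a)
    (hadj : H.Adj a b) : ∃ u, H.Adj b u ∧ u ≠ a ∧ ¬ H.Adj a u := by
  by_contra! hno
  have h1 : ∑ v, (H.dist a v + if v = a then 1 else 0) ≤
      ∑ v, (H.dist b v + if v = b then 1 else 0) := by
    refine Finset.sum_le_sum fun v _ => ?_
    by_cases hva : v = a
    · subst hva
      simp [hadj.ne, SimpleGraph.dist_eq_one_iff_adj.2 hadj.symm]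
    by_cases hvb : v = b
    · subst hvb
      simp [hva, SimpleGraph.dist_eq_one_iff_adj.2 hadj]
    simp only [hva, hvb, if_false, add_zero]
    obtain ⟨p, hp⟩ := hH.exists_walk_length_eq_dist b v
    cases p with
    | nil => exact absurd rfl hvb
    | @cons _ u _ hu p =>
      rw [← hp, SimpleGraph.Walk.length_cons]
      by_cases hua : u = a
      · subst hua
        exact (SimpleGraph.dist_le p).trans (Nat.le_succ _)
      · exact SimpleGraph.dist_le (.cons (hno u hu hua) p)
  simp only [Finset.sum_add_distrib, Finset.sum_ite_eq', Finset.mem_univ, if_true] at h1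
  unfold closeness at hc
  omega

lemma GoodConfig.exists_step (hG : G.Connected) (hc : closeness G b < closeness G a)
    {c : Config V} (h : GoodConfig G a b k c) :
    (∃ S, c = .done S) ∨ ∃ c', Step G a b k c c' := by
  have hab : a ≠ b := by rintro rfl; exact hc.ne rfl
  cases c with
  | done S => exact .inl ⟨S, rfl⟩
  | start =>
    right
    by_cases hadj : G.Adj a b
    · exact ⟨_, .startAdj hadj⟩
    by_cases hcr : Crossed G a b {s(a, b)}
    · obtain ⟨R, hR⟩ := exists_isBetterOf (G := G) (a := a) (b := b) {s(a, b)} ∅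
      exact ⟨_, .startReturn hadj hcr R hR⟩
    · exact ⟨_, .startEnter hadj hcr⟩
  | head S =>
    right
    obtain ⟨⟨W, hW⟩, hnc, hcard⟩ := h
    by_cases hS : S.card < k
    · obtain ⟨u, hb, hne, ha⟩ := exists_candidate (addEdges_connected hG S) (not_le.1 hnc)
        (hW.adj_ab hab)
      by_cases hcr : Crossed G a b (insert s(a, u) S)
      · obtain ⟨R, hR⟩ := exists_isBetterOf (G := G) (a := a) (b := b) (insert s(a, u) S) S
        exact ⟨_, .loopReturn S hS u hb hne ha hcr R hR⟩
      · exact ⟨_, .loopNext S hS u hb hne ha hcr⟩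
    · obtain ⟨R, hR⟩ := exists_isBetterOf (G := G) (a := a) (b := b) S ∅
      exact ⟨_, .loopExit S hS R hR⟩

lemma acc_done (S : Finset (Sym2 V)) :
    Acc (fun c' c => Step G a b k c c') (.done S) :=
  ⟨_, fun _ h => by cases h⟩

lemma acc_head (N : ℕ) : ∀ S : Finset (Sym2 V), k - S.card ≤ N →
    Acc (fun c' c => Step G a b k c c') (.head S) := by
  induction N with
  | zero =>
    intro S hS
    refine ⟨_, fun c h => ?_⟩
    cases h with
    | loopReturn => exact acc_done _
    | loopExit => exact acc_done _
    | loopNext => omega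
  | succ N ih =>
    intro S hS
    refine ⟨_, fun c h => ?_⟩
    cases h with
    | loopReturn => exact acc_done _
    | loopExit => exact acc_done _
    | loopNext _ hS' u hb hne ha =>
      apply ih
      have hm : s(a, u) ∉ S := fun hm => ha (addEdges_adj.2 (.inr ⟨hm, hne.symm⟩))
      rw [Finset.card_insert_of_notMem hm]
      omega

/-- Every run terminates, since every pass through the loop adds an edge. -/
lemma acc_start : Acc (fun c' c => Step G a b k c c') .start := by
  refine ⟨_, fun c h => ?_⟩
  cases h with
  | startReturn => exact acc_done _
  | startAdj => exact acc_head _ _ le_rfl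
  | startEnter => exact acc_head _ _ le_rfl

end Runs

/-! ### Program logic for the word RAM, and the invariant of breadth-first search -/

section WordRam

variable {w : ℕ}

/-- The program `p`, started in `s`, halts after some time `t` in some state `s'` with `Q t s'`. -/
def Wp (w : ℕ) (p : Prog) (s : State) (Q : ℕ → State → Prop) : Prop :=
  ∃ t s', Exec w p s t s' ∧ Q t s'

lemma Wp.mono {p : Prog} {s : State} {Q Q' : ℕ → State → Prop} (h : Wp w p s Q)
    (hQ : ∀ t s', Q t s' → Q' t s') : Wp w p s Q' := by
  obtain ⟨t, s', h1, h2⟩ := h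
  exact ⟨t, s', h1, hQ _ _ h2⟩

lemma wp_skip {s : State} {Q : ℕ → State → Prop} : Wp w .skip s Q ↔ Q 1 s := by
  constructor
  · rintro ⟨t, s', h, hQ⟩
    cases h
    exact hQ
  · exact fun h => ⟨_, _, .skip s, h⟩

lemma wp_assign {x : ℕ} {e : Expr} {s : State} {Q : ℕ → State → Prop} :
    Wp w (.assign x e) s Q ↔ Q (e.cost + 1) (s.setReg x (e.eval w s)) := by
  constructor
  · rintro ⟨t, s', h, hQ⟩
    cases h
    exact hQ
  · exact fun h => ⟨_, _, .assign x e s, h⟩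

lemma wp_store {A : ℕ} {i e : Expr} {s : State} {Q : ℕ → State → Prop} :
    Wp w (.store A i e) s Q ↔
      Q (i.cost + e.cost + 1) (s.setMem A (i.eval w s) (e.eval w s)) := by
  constructor
  · rintro ⟨t, s', h, hQ⟩
    cases h
    exact hQ
  · exact fun h => ⟨_, _, .store A i e s, h⟩

lemma wp_seq {p q : Prog} {s : State} {Q : ℕ → State → Prop} :
    Wp w (.seq p q) s Q ↔ Wp w p s fun t s' => Wp w q s' fun t' s'' => Q (t + t') s'' := by
  constructor
  · rintro ⟨t, s', h, hQ⟩
    cases h with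
    | seq h1 h2 => exact ⟨_, _, h1, _, _, h2, hQ⟩
  · rintro ⟨t, s', h1, t', s'', h2, hQ⟩
    exact ⟨_, _, .seq h1 h2, hQ⟩

lemma wp_ite {e : Expr} {p q : Prog} {s : State} {Q : ℕ → State → Prop} :
    Wp w (.ite e p q) s Q ↔
      (e.eval w s ≠ 0 → Wp w p s fun t s' => Q (e.cost + 1 + t) s') ∧
      (e.eval w s = 0 → Wp w q s fun t s' => Q (e.cost + 1 + t) s') := by
  constructor
  · rintro ⟨t, s', h, hQ⟩
    cases h with
    | iteTrue he h => exact ⟨fun _ => ⟨_, _, h, hQ⟩, fun h' => absurd h' he⟩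
    | iteFalse he h => exact ⟨fun h' => absurd he h', fun _ => ⟨_, _, h, hQ⟩⟩
  · rintro ⟨h1, h2⟩
    by_cases he : e.eval w s = 0
    · obtain ⟨t, s', h, hQ⟩ := h2 he
      exact ⟨_, _, .iteFalse he h, hQ⟩
    · obtain ⟨t, s', h, hQ⟩ := h1 he
      exact ⟨_, _, .iteTrue he h, hQ⟩

/-- Rule for loops. The invariant `I T s` speaks of the remaining time `T`, so that it proves
termination and the time bound together. -/
lemma wp_loop {e : Expr} {p : Prog} (I : ℕ → State → Prop) {R : State → Prop}
    (hfin : ∀ T s, I T s → e.eval w s = 0 → e.cost + 1 ≤ T ∧ R s)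
    (hstep : ∀ T s, I T s → e.eval w s ≠ 0 →
      Wp w p s fun t s' => ∃ T', e.cost + 1 + t + T' ≤ T ∧ I T' s') :
    ∀ T s, I T s → Wp w (.loop e p) s fun t s' => t ≤ T ∧ R s' := by
  intro T
  induction T using Nat.strong_induction_on with
  | _ T ih =>
    intro s hs
    by_cases he : e.eval w s = 0
    · exact ⟨_, _, .loopFalse he, hfin T s hs he⟩
    · obtain ⟨t, s', h1, T', h2, h3⟩ := hstep T s hs he
      obtain ⟨t', s'', h4, h5, h6⟩ := ih T' (by omega) s' h3
      exact ⟨_, _, .loopTrue he h1 h4, by omega, h6⟩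

@[simp] lemma State.setReg_reg (s : State) (x v y : ℕ) :
    (s.setReg x v).reg y = if y = x then v else s.reg y := by
  simp [State.setReg, Function.update_apply]

@[simp] lemma State.setReg_mem (s : State) (x v : ℕ) : (s.setReg x v).mem = s.mem := rfl

@[simp] lemma State.setMem_reg (s : State) (A i v : ℕ) : (s.setMem A i v).reg = s.reg := rfl

lemma State.setMem_mem (s : State) (A i v B : ℕ) :
    (s.setMem A i v).mem B = if B = A then Function.update (s.mem A) i v else s.mem B := by
  simp [State.setMem, Function.update_apply]

end WordRam

section Bfs

/-- Some cell of the list of `v` contains `x`. -/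
def Listed (off nbr : ℕ → ℕ) (v x : ℕ) : Prop :=
  ∃ i, off v ≤ i ∧ i < off (v + 1) ∧ nbr i = x

/-- What breadth-first search needs to know of the arrays: the lists have entries below `n`, no
repetitions, and `v` is not in its own list. -/
structure ListArray (n : ℕ) (off nbr : ℕ → ℕ) : Prop where
  off_le : ∀ v < n, off v ≤ off (v + 1)
  nbr_lt : ∀ v < n, ∀ i, off v ≤ i → i < off (v + 1) → nbr i < n
  nbr_ne : ∀ v < n, ∀ i, off v ≤ i → i < off (v + 1) → nbr i ≠ v
  nbr_inj : ∀ v < n, ∀ i j, off v ≤ i → i < off (v + 1) → off v ≤ j → j < off (v + 1) →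
    nbr i = nbr j → i = j

/-- Invariant of breadth-first search from `r`. The queue `Q` has `τ` entries, of which the first
`h` have been processed; `K v = 0` says that `v` has not been found. The keys `K` increase by `n`
along search edges and start with `2 n + j` at the `j`-th neighbour of `r`. The queue is sorted
by keys, and its unprocessed part spans at most `n`. -/
structure BfsInv (n : ℕ) (off nbr : ℕ → ℕ) (r : ℕ) (K Q : ℕ → ℕ) (h τ : ℕ) : Prop where
  root : K r = n
  first : ∀ j, off r + j < off (r + 1) → K (nbr (off r + j)) = 2 * n + j
  queue : ∀ j < τ, Q j < n ∧ Q j ≠ r ∧ K (Q j) ≠ 0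
  inj : ∀ i < τ, ∀ j < τ, Q i = Q j → i = j
  found : ∀ v, K v ≠ 0 → v = r ∨ ∃ j < τ, Q j = v
  sorted : ∀ i j, i ≤ j → j < τ → K (Q i) ≤ K (Q j)
  span : h < τ → ∀ j < τ, K (Q j) ≤ K (Q h) + n
  edge : ∀ j < h, ∀ x, Listed off nbr (Q j) x → K x ≠ 0 ∧ K x ≤ K (Q j) + n
  parent : ∀ v, K v ≠ 0 → v = r ∨ Listed off nbr r v ∨
    ∃ v', v' ≠ r ∧ K v' ≠ 0 ∧ Listed off nbr v' v ∧ K v = K v' + n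
  bound : ∀ j < τ, K (Q j) ≤ 3 * n + n * j
  head_le : h ≤ τ

/-- The state of the keys after breadth-first search. -/
structure BfsResult (n : ℕ) (off nbr : ℕ → ℕ) (r : ℕ) (K : ℕ → ℕ) : Prop where
  root : K r = n
  first : ∀ j, off r + j < off (r + 1) → K (nbr (off r + j)) = 2 * n + j
  edge : ∀ v, v ≠ r → K v ≠ 0 → ∀ x, Listed off nbr v x → K x ≠ 0 ∧ K x ≤ K v + n
  parent : ∀ v, K v ≠ 0 → v = r ∨ Listed off nbr r v ∨
    ∃ v', v' ≠ r ∧ K v' ≠ 0 ∧ Listed off nbr v' v ∧ K v = K v' + n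
  bound : ∀ v, K v ≤ 3 * n + n * n

variable {n : ℕ} {off nbr : ℕ → ℕ} {r : ℕ} {K Q : ℕ → ℕ} {h τ : ℕ}

lemma card_le_of_inj (hQ : ∀ j < τ, Q j < n) (hinj : ∀ i < τ, ∀ j < τ, Q i = Q j → i = j) :
    τ ≤ n := by
  have := Finset.card_le_card_of_injOn (s := Finset.range τ) (t := Finset.range n) Q
    (by intro j hj; simpa using hQ j (by simpa using hj))
    (by intro i hi j hj hij; exact hinj i (by simpa using hi) j (by simpa using hj) hij)
  simpa using this

lemma ListArray.degree_le (hL : ListArray n off nbr) {v : ℕ} (hv : v < n) :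
    off (v + 1) ≤ off v + n := by
  have := card_le_of_inj (n := n) (τ := off (v + 1) - off v) (Q := fun j => nbr (off v + j))
    (fun j hj => hL.nbr_lt v hv _ (by omega) (by omega))
    (fun i hi j hj hij => by
      have := hL.nbr_inj v hv _ _ (by omega) (by omega) (by omega) (by omega) hij
      omega)
  omega

lemma ListArray.sum_degree (hL : ListArray n off nbr) (h0 : off 0 = 0) {m : ℕ} (hm : m ≤ n) :
    ∑ v ∈ Finset.range m, (off (v + 1) - off v) = off m := by
  induction m with
  | zero => simp [h0]
  | succ m ih =>
    rw [Finset.sum_range_succ, ih (by omega)]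
    have := hL.off_le m hm
    omega

lemma BfsInv.tail_le (hI : BfsInv n off nbr r K Q h τ) : τ ≤ n :=
  card_le_of_inj (fun j hj => (hI.queue j hj).1) hI.inj

lemma BfsInv.next (hI : BfsInv n off nbr r K Q h τ) (hh : h < τ)
    (he : ∀ x, Listed off nbr (Q h) x → K x ≠ 0 ∧ K x ≤ K (Q h) + n) :
    BfsInv n off nbr r K Q (h + 1) τ where
  root := hI.root
  first := hI.first
  queue := hI.queue
  inj := hI.inj
  found := hI.found
  sorted := hI.sorted
  span h' j hj := (hI.span hh j hj).trans (by
    have := hI.sorted h (h + 1) (Nat.le_succ _) h'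
    omega)
  edge j hj x hx := by
    rcases Nat.lt_succ_iff_lt_or_eq.1 hj with hj | rfl
    · exact hI.edge j hj x hx
    · exact he x hx
  parent := hI.parent
  bound := hI.bound
  head_le := hh

lemma BfsInv.push (hL : ListArray n off nbr) (hr : r < n) (hI : BfsInv n off nbr r K Q h τ)
    (hh : h < τ) {x : ℕ}
    (hx : Listed off nbr (Q h) x) (hK : K x = 0) :
    BfsInv n off nbr r (Function.update K x (K (Q h) + n)) (Function.update Q τ x) h (τ + 1) := by
  obtain ⟨hq1, hq2, hq3⟩ := hI.queue h hh
  have hxn : x < n := by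
    obtain ⟨i, h1, h2, rfl⟩ := hx
    exact hL.nbr_lt _ hq1 i h1 h2
  have hKx : ∀ y, K y ≠ 0 → Function.update K x (K (Q h) + n) y = K y := by
    intro y hy
    rw [Function.update_of_ne]
    rintro rfl; exact hy hK
  have hQx : ∀ j < τ, Function.update Q τ x j = Q j := fun j hj =>
    Function.update_of_ne (by omega) _ _
  have hKQ : ∀ j < τ, Function.update K x (K (Q h) + n) (Function.update Q τ x j) = K (Q j) :=
    fun j hj => by rw [hQx j hj, hKx _ (hI.queue j hj).2.2]
  have hKτ : Function.update K x (K (Q h) + n) (Function.update Q τ x τ) = K (Q h) + n := by simp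
  have hxr : x ≠ r := by
    rintro rfl
    have := hI.root
    omega
  refine ⟨?_, ?_, ?_, ?_, ?_, ?_, ?_, ?_, ?_, ?_, ?_⟩
  · rw [hKx _ (by rw [hI.root]; omega), hI.root]
  · intro j hj
    have := hI.first j hj
    rw [hKx _ (by omega), this]
  · intro j hj
    rcases Nat.lt_succ_iff_lt_or_eq.1 hj with hj | rfl
    · rw [hKQ j hj, hQx j hj]; exact hI.queue j hj
    · rw [hKτ, Function.update_self]; exact ⟨hxn, hxr, by omega⟩
  · have hne : ∀ j < τ, Q j ≠ x := fun j hj hjx => (hI.queue j hj).2.2 (hjx ▸ hK)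
    intro i hi j hj hij
    rcases Nat.lt_succ_iff_lt_or_eq.1 hi with hi | rfl <;>
      rcases Nat.lt_succ_iff_lt_or_eq.1 hj with hj | rfl
    · rw [hQx i hi, hQx j hj] at hij; exact hI.inj i hi j hj hij
    · rw [hQx i hi, Function.update_self] at hij; exact absurd hij (hne i hi)
    · rw [hQx j hj, Function.update_self] at hij; exact absurd hij.symm (hne j hj)
    · rfl
  · intro v hv
    by_cases hvx : v = x
    · exact .inr ⟨τ, by omega, by simp [hvx]⟩
    · rw [Function.update_of_ne hvx] at hv
      rcases hI.found v hv with h1 | ⟨j, hj, h1⟩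
      · exact .inl h1
      · exact .inr ⟨j, by omega, by rw [hQx j hj]; exact h1⟩
  · intro i j hij hj
    rcases Nat.lt_succ_iff_lt_or_eq.1 hj with hj | rfl
    · rw [hKQ i (by omega), hKQ j hj]; exact hI.sorted i j hij hj
    · rw [hKτ]
      rcases Nat.lt_or_ge i j with hi | hi
      · rw [hKQ i hi]; exact hI.span hh i hi
      · obtain rfl : i = j := by omega
        rw [hKτ]
  · intro _ j hj
    rw [hKQ h hh]
    rcases Nat.lt_succ_iff_lt_or_eq.1 hj with hj | rfl
    · rw [hKQ j hj]; exact hI.span hh j hj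
    · rw [hKτ]
  · intro j hj y hy
    rw [hKQ j (by omega)]
    rw [hQx j (by omega)] at hy
    have := hI.edge j hj y hy
    rw [hKx _ this.1]
    exact this
  · intro v hv
    by_cases hvx : v = x
    · subst hvx
      refine .inr (.inr ⟨Q h, hq2, by rw [hKx _ hq3]; exact hq3, hx, ?_⟩)
      rw [Function.update_self, hKx _ hq3]
    · rw [Function.update_of_ne hvx] at hv ⊢
      rcases hI.parent v hv with h1 | h1 | ⟨v', h1, h2, h3, h4⟩
      · exact .inl h1
      · exact .inr (.inl h1)
      · refine .inr (.inr ⟨v', h1, ?_, h3, ?_⟩) <;> rw [hKx _ h2]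
        · exact h2
        · exact h4
  · intro j hj
    rcases Nat.lt_succ_iff_lt_or_eq.1 hj with hj | rfl
    · rw [hKQ j hj]; exact hI.bound j hj
    · rw [hKτ]
      have h1 := hI.bound h hh
      have h2 : n * (h + 1) ≤ n * j := Nat.mul_le_mul_left _ hh
      rw [Nat.mul_add] at h2
      omega
  · omega

lemma BfsInv.result (hI : BfsInv n off nbr r K Q τ τ) :
    BfsResult n off nbr r K where
  root := hI.root
  first := hI.first
  edge v hv hK x hx := by
    rcases hI.found v hK with h1 | ⟨j, hj, rfl⟩
    · exact absurd h1 hv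
    · exact hI.edge j hj x hx
  parent := hI.parent
  bound v := by
    by_cases hK : K v = 0
    · omega
    rcases hI.found v hK with rfl | ⟨j, hj, rfl⟩
    · rw [hI.root]; omega
    · have h1 := hI.bound j hj
      have h2 : n * j ≤ n * n := Nat.mul_le_mul_left _ (hj.le.trans hI.tail_le)
      omega

/-- The lists of the first `h'` vertices of the queue have at most `off n` entries together, which
bounds the time spent on scanning lists. -/
lemma BfsInv.sum_degree_le (hL : ListArray n off nbr) (h0 : off 0 = 0)
    (hI : BfsInv n off nbr r K Q h τ) {h' : ℕ} (hh : h' ≤ τ) :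
    ∑ j ∈ Finset.range h', (off (Q j + 1) - off (Q j)) ≤ off n := by
  rw [← hL.sum_degree h0 le_rfl, ← Finset.sum_image (f := fun v => off (v + 1) - off v) (g := Q)]
  · refine Finset.sum_le_sum_of_subset fun v hv => ?_
    obtain ⟨j, hj, rfl⟩ := Finset.mem_image.1 hv
    exact Finset.mem_range.2 (hI.queue j (by have := Finset.mem_range.1 hj; omega)).1
  · intro i hi j hj hij
    have := Finset.mem_range.1 hi
    have := Finset.mem_range.1 hj
    exact hI.inj i (by omega) j (by omega) hij

end Bfs

/-! ### Breadth-first search: programs and the first layer -/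

/-- Sequential composition of programs. -/
infixr:60 " ;; " => CRI.Prog.seq

section Bfs

/-- Put `K r = n` for the root `r` in register `4`, and fill the queue with its neighbours. -/
def bfsInit (κ : ℕ) : Prog :=
  .store κ (.reg 4) (.reg 0) ;;
  .assign 5 (.const 0) ;;
  .assign 6 (.get 0 (.reg 4)) ;;
  .assign 7 (.get 0 (.bin .add (.reg 4) (.const 1))) ;;
  .loop (.bin .lt (.reg 6) (.reg 7)) (
    .assign 10 (.get 1 (.reg 6)) ;;
    .store κ (.reg 10) (.bin .add (.bin .add (.reg 0) (.reg 0)) (.reg 5)) ;;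
    .store 4 (.reg 5) (.reg 10) ;;
    .assign 5 (.bin .add (.reg 5) (.const 1)) ;;
    .assign 6 (.bin .add (.reg 6) (.const 1)))

/-- Scan the list from cell `reg 6` to cell `reg 7`; vertices not found before get the key
`reg 11` and are appended to the queue. -/
def bfsScan (κ : ℕ) : Prog :=
  .loop (.bin .lt (.reg 6) (.reg 7)) (
    .assign 10 (.get 1 (.reg 6)) ;;
    .ite (.get κ (.reg 10)) .skip (
      .store κ (.reg 10) (.reg 11) ;;
      .store 4 (.reg 5) (.reg 10) ;;
      .assign 5 (.bin .add (.reg 5) (.const 1))) ;;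
    .assign 6 (.bin .add (.reg 6) (.const 1)))

/-- Process the queue. -/
def bfsMain (κ : ℕ) : Prog :=
  .assign 8 (.const 0) ;;
  .loop (.bin .lt (.reg 8) (.reg 5)) (
    .assign 9 (.get 4 (.reg 8)) ;;
    .assign 11 (.bin .add (.get κ (.reg 9)) (.reg 0)) ;;
    .assign 6 (.get 0 (.reg 9)) ;;
    .assign 7 (.get 0 (.bin .add (.reg 9) (.const 1))) ;;
    bfsScan κ ;;
    .assign 8 (.bin .add (.reg 8) (.const 1)))

/-- Sum up the distances `K v / n - 1` in register `12`. -/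
def bfsSum (κ : ℕ) : Prog :=
  .assign 12 (.const 0) ;;
  .assign 6 (.const 0) ;;
  .loop (.bin .lt (.reg 6) (.reg 0)) (
    .assign 12 (.bin .add (.reg 12)
      (.bin .sub (.bin .div (.get κ (.reg 6)) (.reg 0)) (.const 1))) ;;
    .assign 6 (.bin .add (.reg 6) (.const 1)))

/-- Breadth-first search from the vertex in register `4`; keys go to the array `κ`, the sum of the
distances goes to register `12`. -/
def bfs (κ : ℕ) : Prog := bfsInit κ ;; bfsMain κ ;; bfsSum κ

/-- The registers and arrays that breadth-first search leaves alone. -/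
def BfsFrame (κ : ℕ) (s s' : State) : Prop :=
  (∀ x, x ≤ 4 ∨ 13 ≤ x → s'.reg x = s.reg x) ∧ ∀ A, A ≠ 4 → A ≠ κ → s'.mem A = s.mem A

lemma BfsFrame.refl (κ : ℕ) (s : State) : BfsFrame κ s s := ⟨fun _ _ => rfl, fun _ _ _ => rfl⟩

lemma BfsFrame.trans {κ : ℕ} {s s' s'' : State} (h : BfsFrame κ s s') (h' : BfsFrame κ s' s'') :
    BfsFrame κ s s'' :=
  ⟨fun x hx => (h'.1 x hx).trans (h.1 x hx), fun A h4 hκ => (h'.2 A h4 hκ).trans (h.2 A h4 hκ)⟩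

lemma BfsFrame.setReg {κ : ℕ} {s s' : State} (h : BfsFrame κ s s') {x : ℕ} (v : ℕ) (h4 : 4 < x)
    (h13 : x < 13) : BfsFrame κ s (s'.setReg x v) := by
  refine ⟨fun y hy => ?_, h.2⟩
  rw [State.setReg_reg, if_neg (by omega)]
  exact h.1 y hy

lemma BfsFrame.setMem {κ : ℕ} {s s' : State} (h : BfsFrame κ s s') {A : ℕ} (i v : ℕ)
    (hA : A = 4 ∨ A = κ) : BfsFrame κ s (s'.setMem A i v) := by
  refine ⟨h.1, fun B h4 hκ => ?_⟩
  rw [State.setMem_mem, if_neg (by rintro rfl; tauto)]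
  exact h.2 B h4 hκ

/-- The input of breadth-first search. -/
structure BfsInput (n : ℕ) (off nbr : ℕ → ℕ) (r κ w : ℕ) (s : State) : Prop where
  list : ListArray n off nbr
  root_lt : r < n
  off_zero : off 0 = 0
  off_lt : off n < 2 ^ w
  word : 4 * (n * n) + 8 * n + 8 ≤ 2 ^ w
  reg_zero : s.reg 0 = n
  reg_four : s.reg 4 = r
  mem_zero : s.mem 0 = off
  mem_one : s.mem 1 = nbr
  array : 5 ≤ κ

lemma BfsInput.of_frame {n : ℕ} {off nbr : ℕ → ℕ} {r κ w : ℕ} {s s' : State}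
    (h : BfsInput n off nbr r κ w s) (hf : BfsFrame κ s s') : BfsInput n off nbr r κ w s' :=
  { h with
    reg_zero := (hf.1 0 (by omega)).trans h.reg_zero
    reg_four := (hf.1 4 (by omega)).trans h.reg_four
    mem_zero := (hf.2 0 (by omega) (by have := h.array; omega)).trans h.mem_zero
    mem_one := (hf.2 1 (by omega) (by have := h.array; omega)).trans h.mem_one }

variable {n : ℕ} {off nbr : ℕ → ℕ} {r κ w : ℕ}

lemma ListArray.off_le_last (hL : ListArray n off nbr) {v : ℕ} (hv : v ≤ n) : off v ≤ off n :=
  Nat.decreasingInduction (motive := fun m _ => off m ≤ off n)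
    (fun m hm ih => (hL.off_le m hm).trans ih) le_rfl hv

lemma wp_bfsInit {s : State} (hI : BfsInput n off nbr r κ w s) (hK : ∀ v, s.mem κ v = 0) :
    Wp w (bfsInit κ) s fun t s' => t ≤ 40 * (n + 1) ∧ BfsFrame κ s s' ∧
      BfsInv n off nbr r (s'.mem κ) (s'.mem 4) 0 (s'.reg 5) := by
  obtain ⟨hL, hr, h0, hoff, hM, hs0, hs4, hm0, hm1, hκ⟩ := hI
  have hdeg := hL.degree_le hr
  have hle := hL.off_le r hr
  have hlast : off (r + 1) ≤ off n := hL.off_le_last hr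
  have c0 : 0 % 2 ^ w = 0 := Nat.zero_mod _
  have c1 : 1 % 2 ^ w = 1 := Nat.mod_eq_of_lt (by omega)
  have c2 : (r + 1) % 2 ^ w = r + 1 := Nat.mod_eq_of_lt (by omega)
  have c3 : (n + n) % 2 ^ w = n + n := Nat.mod_eq_of_lt (by omega)
  have hκ4 : κ ≠ 4 := by omega
  have hκ0 : κ ≠ 0 := by omega
  have hκ1 : κ ≠ 1 := by omega
  unfold bfsInit
  simp only [wp_seq, wp_assign, wp_store, Expr.eval, Expr.cost, Op.apply, State.setReg_reg,
    State.setReg_mem, State.setMem_reg, State.setMem_mem, Nat.reduceEqDiff, reduceIte,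
    hκ0.symm, hm0, hs4, hs0, c0, c1, c2]
  refine (wp_loop (fun T s' => ∃ τ, off r + τ ≤ off (r + 1) ∧ BfsFrame κ s s' ∧ s'.reg 5 = τ ∧
      s'.reg 6 = off r + τ ∧ s'.reg 7 = off (r + 1) ∧ s'.mem κ r = n ∧
      (∀ j < τ, s'.mem κ (nbr (off r + j)) = 2 * n + j) ∧
      (∀ v, s'.mem κ v ≠ 0 → v = r ∨ ∃ j < τ, nbr (off r + j) = v) ∧
      (∀ j < τ, s'.mem 4 j = nbr (off r + j)) ∧ 30 * (off (r + 1) - (off r + τ)) + 4 ≤ T)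
    (R := fun s' => BfsFrame κ s s' ∧
      BfsInv n off nbr r (s'.mem κ) (s'.mem 4) 0 (s'.reg 5)) ?_ ?_ (30 * n + 4) _ ?_).mono ?_
  · rintro T s' ⟨τ, h1, hf, h5, h6, h7, hroot, hfirst, hfound, hq, hT⟩ he
    simp only [Expr.eval, Expr.cost, Op.apply, h6, h7] at he ⊢
    have : off (r + 1) = off r + τ := by
      by_contra hne
      rw [if_pos (by omega)] at he
      omega
    refine ⟨by omega, hf, ?_⟩
    rw [h5]
    have hcell : ∀ j < τ, off r + j < off (r + 1) := fun j hj => by omega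
    refine ⟨hroot, fun j hj => hfirst j (by omega), fun j hj => ?_, fun i hi j hj hij => ?_,
      fun v hv => ?_, fun i j hij hj => ?_, fun h j hj => ?_, fun j hj => ?_, fun v hv => ?_,
      fun j hj => ?_, Nat.zero_le _⟩
    · rw [hq j hj]
      refine ⟨hL.nbr_lt r hr _ (by omega) (hcell j hj), hL.nbr_ne r hr _ (by omega) (hcell j hj),
        ?_⟩
      rw [hfirst j hj]; omega
    · rw [hq i hi, hq j hj] at hij
      have := hL.nbr_inj r hr _ _ (by omega) (hcell i hi) (by omega) (hcell j hj) hij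
      omega
    · rcases hfound v hv with h | ⟨j, hj, h⟩
      · exact .inl h
      · exact .inr ⟨j, hj, by rw [hq j hj]; exact h⟩
    · rw [hq j hj, hq i (by omega), hfirst j hj, hfirst i (by omega)]; omega
    · rw [hq j hj, hq 0 h, hfirst j hj, hfirst 0 h]; omega
    · omega
    · rcases hfound v hv with h | ⟨j, hj, h⟩
      · exact .inl h
      · exact .inr (.inl ⟨off r + j, by omega, hcell j hj, h⟩)
    · rw [hq j hj, hfirst j hj]
      have : 1 * j ≤ n * j := Nat.mul_le_mul_right _ (by omega)
      omega
  · rintro T s' ⟨τ, h1, hf, h5, h6, h7, hroot, hfirst, hfound, hq, hT⟩ he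
    simp only [Expr.eval, Op.apply, h6, h7, ne_eq, ite_eq_right_iff, not_forall] at he
    obtain ⟨hlt, -⟩ := he
    have d1 : (n + n + τ) % 2 ^ w = 2 * n + τ := by rw [Nat.mod_eq_of_lt (by omega)]; omega
    have d2 : (τ + 1) % 2 ^ w = τ + 1 := Nat.mod_eq_of_lt (by omega)
    have d3 : (off r + τ + 1) % 2 ^ w = off r + (τ + 1) := by
      rw [Nat.mod_eq_of_lt (by omega)]; omega
    have f0 : s'.reg 0 = n := (hf.1 0 (by omega)).trans hs0
    have f1 : s'.mem 1 = nbr := (hf.2 1 (by omega) hκ1.symm).trans hm1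
    simp only [wp_seq, wp_assign, wp_store, Expr.eval, Expr.cost, Op.apply, State.setReg_reg,
      State.setReg_mem, State.setMem_reg, State.setMem_mem, Nat.reduceEqDiff, reduceIte, c1,
      hκ4.symm, hκ4, f0, f1, h5, h6, h7, c3, d1, d2, d3]
    have hx := hL.nbr_ne r hr (off r + τ) (by omega) hlt
    refine ⟨30 * (off (r + 1) - (off r + (τ + 1))) + 4, by omega, τ + 1, by omega, ?_, rfl, rfl,
      trivial, ?_, ?_, ?_, ?_, le_rfl⟩
    · refine BfsFrame.setReg (BfsFrame.setReg (BfsFrame.setMem (BfsFrame.setMem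
        (BfsFrame.setReg hf _ ?_ ?_) _ _ ?_) _ _ ?_) _ ?_ ?_) _ ?_ ?_ <;> omega
    · rw [Function.update_of_ne hx.symm]; exact hroot
    · intro j hj
      rcases Nat.lt_succ_iff_lt_or_eq.1 hj with hj | rfl
      · rw [Function.update_of_ne]
        · exact hfirst j hj
        · intro h
          have := hL.nbr_inj r hr _ _ (by omega) (by omega) (by omega) hlt h
          omega
      · simp
    · intro v hv
      by_cases hvx : v = nbr (off r + τ)
      · exact .inr ⟨τ, by omega, hvx.symm⟩
      · rw [Function.update_of_ne hvx] at hv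
        rcases hfound v hv with h | ⟨j, hj, h⟩
        · exact .inl h
        · exact .inr ⟨j, by omega, h⟩
    · intro j hj
      rcases Nat.lt_succ_iff_lt_or_eq.1 hj with hj | rfl
      · rw [Function.update_of_ne (by omega)]; exact hq j hj
      · simp
  · refine ⟨0, by omega, ?_, ?_, ?_, ?_, ?_, ?_, ?_, ?_, ?_⟩
    · refine BfsFrame.setReg (BfsFrame.setReg (BfsFrame.setReg (BfsFrame.setMem
        (BfsFrame.refl _ _) _ _ ?_) _ ?_ ?_) _ ?_ ?_) _ ?_ ?_ <;> omega
    all_goals norm_num [State.setMem_mem, hκ4.symm, hκ4, hκ0.symm, hm0, hK]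
    · intro v hv
      by_contra hvr
      rw [Function.update_of_ne hvr, hK] at hv
      exact hv rfl
    · omega
  · rintro t s' ⟨h1, h2⟩
    exact ⟨by omega, h2⟩

end Bfs

/-! ### Breadth-first search: the queue and the sum of the distances -/

section Bfs

variable {n : ℕ} {off nbr : ℕ → ℕ} {r κ w : ℕ}

lemma wp_bfsScan {s : State} (hI : BfsInput n off nbr r κ w s) {h v : ℕ}
    (hB : BfsInv n off nbr r (s.mem κ) (s.mem 4) h (s.reg 5)) (hh : h < s.reg 5)
    (hv : s.mem 4 h = v) (h6 : s.reg 6 = off v) (h7 : s.reg 7 = off (v + 1))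
    (h11 : s.reg 11 = s.mem κ v + n) :
    Wp w (bfsScan κ) s fun t s' => t ≤ 40 * (off (v + 1) - off v) + 4 ∧
      (BfsFrame κ s s' ∧ s'.reg 8 = s.reg 8 ∧ (∀ j ≤ h, s'.mem 4 j = s.mem 4 j) ∧
      BfsInv n off nbr r (s'.mem κ) (s'.mem 4) (h + 1) (s'.reg 5)) := by
  have hI' := hI
  obtain ⟨hL, hr, h0, hoff, hM, hs0, hs4, hm0, hm1, hκ⟩ := hI'
  have hvn : v < n := hv ▸ (hB.queue h hh).1
  have hle := hL.off_le v hvn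
  have hlast : off (v + 1) ≤ off n := hL.off_le_last hvn
  have c1 : 1 % 2 ^ w = 1 := Nat.mod_eq_of_lt (by omega)
  have hκ4 : κ ≠ 4 := by omega
  unfold bfsScan
  refine wp_loop (fun T s' => ∃ i, off v ≤ i ∧ i ≤ off (v + 1) ∧ BfsFrame κ s s' ∧
      s'.reg 8 = s.reg 8 ∧ s'.reg 6 = i ∧ s'.reg 7 = off (v + 1) ∧
      s'.reg 11 = s'.mem κ v + n ∧ (∀ j ≤ h, s'.mem 4 j = s.mem 4 j) ∧
      BfsInv n off nbr r (s'.mem κ) (s'.mem 4) h (s'.reg 5) ∧ h < s'.reg 5 ∧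
      (∀ i', off v ≤ i' → i' < i → s'.mem κ (nbr i') ≠ 0 ∧
        s'.mem κ (nbr i') ≤ s'.mem κ v + n) ∧
      40 * (off (v + 1) - i) + 4 ≤ T) ?_ ?_ _ s ?_
  · rintro T s' ⟨i, i1, i2, hf, f8, f6, f7, f11, fQ, fB, fh, fp, hT⟩ he
    simp only [Expr.eval, Expr.cost, Op.apply, f6, f7] at he ⊢
    obtain rfl : i = off (v + 1) := by
      by_contra hne
      rw [if_pos (by omega)] at he
      omega
    refine ⟨by omega, hf, f8, fQ, fB.next fh ?_⟩
    rw [fQ h le_rfl, hv]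
    rintro x ⟨i', i1, i2, rfl⟩
    exact fp i' i1 i2
  · rintro T s' ⟨i, i1, i2, hf, f8, f6, f7, f11, fQ, fB, fh, fp, hT⟩ he
    simp only [Expr.eval, Op.apply, f6, f7, ne_eq, ite_eq_right_iff, not_forall] at he
    obtain ⟨hlt, -⟩ := he
    have hτ := fB.tail_le
    have d2 : (s'.reg 5 + 1) % 2 ^ w = s'.reg 5 + 1 := Nat.mod_eq_of_lt (by omega)
    have d3 : (i + 1) % 2 ^ w = i + 1 := Nat.mod_eq_of_lt (by omega)
    have f1 : s'.mem 1 = nbr := (hI.of_frame hf).mem_one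
    have hKv : s'.mem κ v ≠ 0 := hv ▸ fQ h le_rfl ▸ (fB.queue h fh).2.2
    have hQv : s'.mem 4 h = v := (fQ h le_rfl).trans hv
    simp only [wp_seq, wp_assign, wp_store, wp_ite, wp_skip, Expr.eval, Expr.cost, Op.apply,
      State.setReg_reg, State.setReg_mem, State.setMem_reg, State.setMem_mem, Nat.reduceEqDiff,
      reduceIte, c1, hκ4.symm, hκ4, f1, f6, f7, d2, d3]
    constructor
    · intro hne
      refine ⟨40 * (off (v + 1) - (i + 1)) + 4, by omega, i + 1, by omega, by omega, ?_, f8, rfl,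
        trivial, f11, fQ, fB, fh, ?_, le_rfl⟩
      · refine BfsFrame.setReg (BfsFrame.setReg hf _ ?_ ?_) _ ?_ ?_ <;> omega
      · intro i' j1 j2
        rcases Nat.lt_succ_iff_lt_or_eq.1 j2 with j2 | rfl
        · exact fp i' j1 j2
        · refine ⟨hne, ?_⟩
          rcases fB.found _ hne with h1 | ⟨j, hj, h1⟩
          · rw [h1, fB.root]; omega
          · rw [← h1, ← hQv]; exact fB.span fh j hj
    · intro hz
      have hne : v ≠ nbr i := by rintro rfl; exact hKv hz
      have hpush := fB.push hL hr fh (x := nbr i)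
        ⟨i, by rw [hQv]; omega, by rw [hQv]; omega, rfl⟩ hz
      rw [hQv, ← f11] at hpush
      refine ⟨40 * (off (v + 1) - (i + 1)) + 4, by omega, i + 1, by omega, by omega, ?_, f8, rfl,
        trivial, ?_, ?_, hpush, by omega, ?_, le_rfl⟩
      · refine BfsFrame.setReg (BfsFrame.setReg (BfsFrame.setMem (BfsFrame.setMem
          (BfsFrame.setReg hf _ ?_ ?_) _ _ ?_) _ _ ?_) _ ?_ ?_) _ ?_ ?_ <;> omega
      · rw [Function.update_of_ne hne]; exact f11
      · intro j hj
        rw [Function.update_of_ne (by omega)]; exact fQ j hj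
      · intro i' j1 j2
        rw [Function.update_of_ne hne]
        rcases Nat.lt_succ_iff_lt_or_eq.1 j2 with j2 | rfl
        · have := fp i' j1 j2
          rw [Function.update_of_ne]
          · exact this
          · intro h; rw [h] at this; exact this.1 hz
        · rw [Function.update_self]; omega
  · exact ⟨off v, le_rfl, hle, .refl _ _, rfl, h6, h7, h11, fun _ _ => rfl, hB, hh,
      fun i' h1 h2 => by omega, le_rfl⟩

lemma wp_bfsMain {s : State} (hI : BfsInput n off nbr r κ w s)
    (hB : BfsInv n off nbr r (s.mem κ) (s.mem 4) 0 (s.reg 5)) :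
    Wp w (bfsMain κ) s fun t s' => t ≤ 40 * off n + 50 * n + 6 ∧ (BfsFrame κ s s' ∧
      BfsResult n off nbr r (s'.mem κ)) := by
  have hI' := hI
  obtain ⟨hL, hr, h0, hoff, hM, hs0, hs4, hm0, hm1, hκ⟩ := hI'
  have c1 : 1 % 2 ^ w = 1 := Nat.mod_eq_of_lt (by omega)
  have c0 : 0 % 2 ^ w = 0 := Nat.zero_mod _
  have hκ4 : κ ≠ 4 := by omega
  unfold bfsMain
  simp only [wp_seq, wp_assign, Expr.eval, Expr.cost, c0]
  refine (wp_loop (fun T s' => ∃ h, BfsFrame κ s s' ∧ s'.reg 8 = h ∧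
      BfsInv n off nbr r (s'.mem κ) (s'.mem 4) h (s'.reg 5) ∧
      40 * (off n - ∑ j ∈ Finset.range h, (off (s'.mem 4 j + 1) - off (s'.mem 4 j))) +
        50 * (n - h) + 4 ≤ T)
    (R := fun s' => BfsFrame κ s s' ∧ BfsResult n off nbr r (s'.mem κ))
    ?_ ?_ (40 * off n + 50 * n + 4) _ ?_).mono ?_
  · rintro T s' ⟨h, hf, f8, fB, hT⟩ he
    simp only [Expr.eval, Expr.cost, Op.apply, f8] at he ⊢
    have heq : s'.reg 5 = h := by
      have := fB.head_le
      by_contra hne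
      rw [if_pos (by omega)] at he
      omega
    rw [heq] at fB
    exact ⟨by omega, hf, fB.result⟩
  · rintro T s' ⟨h, hf, f8, fB, hT⟩ he
    simp only [Expr.eval, Op.apply, f8, ne_eq, ite_eq_right_iff, not_forall] at he
    obtain ⟨hlt, -⟩ := he
    have hτ := fB.tail_le
    have hvn := (fB.queue h hlt).1
    have hI2 := hI.of_frame hf
    obtain ⟨v, hv⟩ : ∃ v, s'.mem 4 h = v := ⟨_, rfl⟩
    rw [hv] at hvn
    have f0 := hI2.reg_zero
    have fm0 := hI2.mem_zero
    have hb := fB.bound h hlt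
    rw [hv] at hb
    have hb2 : n * h ≤ n * n := Nat.mul_le_mul_left _ (by omega)
    have d1 : (s'.mem κ v + n) % 2 ^ w = s'.mem κ v + n := Nat.mod_eq_of_lt (by omega)
    have d2 : (v + 1) % 2 ^ w = v + 1 := Nat.mod_eq_of_lt (by omega)
    have d3 : (h + 1) % 2 ^ w = h + 1 := Nat.mod_eq_of_lt (by omega)
    have hsum := fB.sum_degree_le hL h0 (h' := h + 1) hlt
    rw [Finset.sum_range_succ, hv] at hsum
    simp only [wp_seq, wp_assign, Expr.eval, Expr.cost, Op.apply,
      State.setReg_reg, State.setReg_mem, Nat.reduceEqDiff,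
      reduceIte, c1, f0, fm0, f8, hv, d1, d2]
    have hf2 : BfsFrame κ s ((((s'.setReg 9 v).setReg 11 (s'.mem κ v + n)).setReg 6
        (off v)).setReg 7 (off (v + 1))) := by
      refine BfsFrame.setReg (BfsFrame.setReg (BfsFrame.setReg (BfsFrame.setReg hf _ ?_ ?_)
        _ ?_ ?_) _ ?_ ?_) _ ?_ ?_ <;> omega
    refine (wp_bfsScan (hI.of_frame hf2) (h := h) (v := v) ?_ ?_ ?_ ?_ ?_ ?_).mono ?_
    · simpa using fB
    · simpa using hlt
    · simpa using hv
    · simp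
    · simp
    · simp
    · rintro t s2 ⟨ht, g1, g2, g3, g4⟩
      simp only [State.setReg_reg, State.setReg_mem, Nat.reduceEqDiff, reduceIte] at g2 g3
      simp only [g2, f8, d3]
      have hsum2 : ∑ j ∈ Finset.range (h + 1), (off (s2.mem 4 j + 1) - off (s2.mem 4 j)) =
          ∑ j ∈ Finset.range h, (off (s'.mem 4 j + 1) - off (s'.mem 4 j)) +
            (off (v + 1) - off v) := by
        rw [← hv, ← Finset.sum_range_succ]
        refine Finset.sum_congr rfl fun j hj => ?_
        rw [g3 j (by have := Finset.mem_range.1 hj; omega)]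
      refine ⟨_, ?_, h + 1, ?_, by simp, by simpa using g4, le_rfl⟩
      · simp only [hsum2]
        omega
      · exact (hf2.trans g1).setReg _ (by omega) (by omega)
  · exact ⟨0, (BfsFrame.refl _ _).setReg _ (by omega) (by omega), by simp, by simpa using hB,
      by simp⟩
  · rintro t s' ⟨h1, h2⟩
    exact ⟨by omega, h2⟩

lemma wp_bfsSum {s : State} (hI : BfsInput n off nbr r κ w s)
    (hB : BfsResult n off nbr r (s.mem κ)) :
    Wp w (bfsSum κ) s fun t s' => t ≤ 30 * n + 8 ∧ (BfsFrame κ s s' ∧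
      s'.mem κ = s.mem κ ∧ s'.reg 12 = ∑ v ∈ Finset.range n, (s.mem κ v / n - 1)) := by
  have hI' := hI
  obtain ⟨hL, hr, h0, hoff, hM, hs0, hs4, hm0, hm1, hκ⟩ := hI'
  have c1 : 1 % 2 ^ w = 1 := Nat.mod_eq_of_lt (by omega)
  have c0 : 0 % 2 ^ w = 0 := Nat.zero_mod _
  have hbound : ∀ v, s.mem κ v / n - 1 ≤ n + 2 := by
    intro v
    have h1 : s.mem κ v / n ≤ (n * (n + 3)) / n := Nat.div_le_div_right (by
      have := hB.bound v
      rw [Nat.mul_add]; omega)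
    rw [Nat.mul_div_cancel_left _ (by omega)] at h1
    omega
  have hsum : ∀ m ≤ n, ∑ v ∈ Finset.range m, (s.mem κ v / n - 1) ≤ n * n + 2 * n := by
    intro m hm
    calc _ ≤ ∑ v ∈ Finset.range m, (n + 2) := Finset.sum_le_sum fun v _ => hbound v
      _ = m * (n + 2) := by simp
      _ ≤ n * (n + 2) := Nat.mul_le_mul_right _ hm
      _ = _ := by ring
  unfold bfsSum
  simp only [wp_seq, wp_assign, Expr.eval, Expr.cost, c0]
  refine (wp_loop (fun T s' => ∃ i, i ≤ n ∧ BfsFrame κ s s' ∧ s'.mem κ = s.mem κ ∧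
      s'.reg 6 = i ∧ s'.reg 12 = ∑ v ∈ Finset.range i, (s.mem κ v / n - 1) ∧
        30 * (n - i) + 4 ≤ T)
    (R := fun s' => BfsFrame κ s s' ∧ s'.mem κ = s.mem κ ∧
      s'.reg 12 = ∑ v ∈ Finset.range n, (s.mem κ v / n - 1))
    ?_ ?_ (30 * n + 4) _ ?_).mono ?_
  · rintro T s' ⟨i, hi, hf, fK, f6, f12, hT⟩ he
    have f0 := (hI.of_frame hf).reg_zero
    simp only [Expr.eval, Expr.cost, Op.apply, f6, f0] at he ⊢
    obtain rfl : i = n := by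
      by_contra hne
      rw [if_pos (by omega)] at he
      omega
    exact ⟨by omega, hf, fK, f12⟩
  · rintro T s' ⟨i, hi, hf, fK, f6, f12, hT⟩ he
    have f0 := (hI.of_frame hf).reg_zero
    simp only [Expr.eval, Op.apply, f6, f0, ne_eq, ite_eq_right_iff, not_forall] at he
    obtain ⟨hlt, -⟩ := he
    have hs := hsum (i + 1) hlt
    rw [Finset.sum_range_succ, ← f12] at hs
    have d1 : (s'.reg 12 + (s.mem κ i / n - 1)) % 2 ^ w = s'.reg 12 + (s.mem κ i / n - 1) :=
      Nat.mod_eq_of_lt (by omega)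
    have d2 : (i + 1) % 2 ^ w = i + 1 := Nat.mod_eq_of_lt (by omega)
    simp only [wp_seq, wp_assign, Expr.eval, Expr.cost, Op.apply,
      State.setReg_reg, State.setReg_mem, Nat.reduceEqDiff,
      reduceIte, c1, f0, f6, fK, d1, d2]
    refine ⟨30 * (n - (i + 1)) + 4, by omega, i + 1, hlt, ?_, trivial, rfl, ?_, le_rfl⟩
    · refine BfsFrame.setReg (BfsFrame.setReg hf _ ?_ ?_) _ ?_ ?_ <;> omega
    · rw [Finset.sum_range_succ, f12]
  · refine ⟨0, Nat.zero_le _, ?_, rfl, by simp, by simp, le_rfl⟩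
    refine BfsFrame.setReg (BfsFrame.setReg (.refl _ _) _ ?_ ?_) _ ?_ ?_ <;> omega
  · rintro t s' ⟨h1, h2⟩
    exact ⟨by omega, h2⟩

lemma wp_bfs {s : State} (hI : BfsInput n off nbr r κ w s) (hK : ∀ v, s.mem κ v = 0) :
    Wp w (bfs κ) s fun t s' => t ≤ 40 * off n + 200 * (n + 1) ∧ (BfsFrame κ s s' ∧
      BfsResult n off nbr r (s'.mem κ) ∧
      s'.reg 12 = ∑ v ∈ Finset.range n, (s'.mem κ v / n - 1)) := by
  unfold bfs
  rw [wp_seq]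
  refine (wp_bfsInit hI hK).mono fun t s1 ⟨h1, hf1, hB1⟩ => ?_
  rw [wp_seq]
  refine (wp_bfsMain (hI.of_frame hf1) hB1).mono fun t s2 ⟨h2, hf2, hB2⟩ => ?_
  refine (wp_bfsSum (hI.of_frame (hf1.trans hf2)) hB2).mono fun t s3 ⟨h3, hf3, hK3, hB3⟩ => ?_
  refine ⟨by omega, (hf1.trans hf2).trans hf3, ?_, ?_⟩
  · rw [hK3]; exact hB2
  · rw [hK3]; exact hB3

end Bfs

/-! ### Keys and distances -/

section Bridge

variable {n : ℕ} {G : SimpleGraph (Fin n)} {off nbr : ℕ → ℕ}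

lemma IsAdjacencyArray.exists_adj (h : IsAdjacencyArray G off nbr) {v : Fin n} {i : ℕ}
    (h1 : off v ≤ i) (h2 : i < off (v + 1)) : ∃ u : Fin n, G.Adj v u ∧ nbr i = u := by
  obtain ⟨u, hu, he⟩ := (h.bijOn v).mapsTo ⟨h1, h2⟩
  exact ⟨u, hu, he.symm⟩

lemma IsAdjacencyArray.exists_index (h : IsAdjacencyArray G off nbr) {v u : Fin n}
    (hu : G.Adj v u) : ∃ i, off v ≤ i ∧ i < off (v + 1) ∧ nbr i = u := by
  obtain ⟨i, hi, he⟩ := (h.bijOn v).surjOn ⟨u, hu, rfl⟩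
  exact ⟨i, hi.1, hi.2, he⟩

lemma IsAdjacencyArray.listArray (h : IsAdjacencyArray G off nbr) : ListArray n off nbr where
  off_le := h.off_le
  nbr_lt v hv i h1 h2 := by
    obtain ⟨u, -, he⟩ := h.exists_adj (v := ⟨v, hv⟩) h1 h2
    rw [he]; exact u.2
  nbr_ne v hv i h1 h2 := by
    obtain ⟨u, hu, he⟩ := h.exists_adj (v := ⟨v, hv⟩) h1 h2
    rw [he]
    rintro rfl
    exact hu.ne rfl
  nbr_inj v hv i j h1 h2 h3 h4 hij := (h.bijOn ⟨v, hv⟩).injOn ⟨h1, h2⟩ ⟨h3, h4⟩ hij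

lemma IsAdjacencyArray.off_last (h : IsAdjacencyArray G off nbr) :
    off n = 2 * G.edgeSet.ncard := by
  classical
  have h1 : ∀ v : Fin n, G.degree v = off (v + 1) - off v := by
    intro v
    have := (h.bijOn v).image_eq
    have h2 := (h.bijOn v).injOn.ncard_image
    rw [this, Set.ncard_image_of_injective _ Fin.val_injective,
      ← Nat.card_coe_set_eq, Nat.card_eq_fintype_card, SimpleGraph.card_neighborSet_eq_degree] at h2
    rw [h2, ← Nat.card_Ico, Set.ncard_eq_toFinset_card']
    simp
  rw [← h.listArray.sum_degree h.off_zero le_rfl, Finset.sum_range,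
    ← Finset.sum_congr rfl fun v _ => h1 v,
    SimpleGraph.sum_degrees_eq_twice_card_edges, Set.ncard_eq_toFinset_card']
  simp [SimpleGraph.edgeFinset]

/-- After breadth-first search from `r` the key of `v` is `n (d(r, v) + 1) + l`, where `l < n`; for
`v ≠ r`, this `l` is the least index in the list of `r` of a neighbour `u` of `r` that lies on a
shortest path from `r` to `v`. -/
structure Labelled (G : SimpleGraph (Fin n)) (off nbr : ℕ → ℕ) (r : Fin n) (K lab : ℕ → ℕ) :
    Prop where
  key : ∀ v : Fin n, K v = n * (G.dist r v + 1) + lab v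
  lab_lt : ∀ v : Fin n, lab v < n
  lab_mem : ∀ v : Fin n, v ≠ r → off r + lab v < off (r + 1)
  lab_dist : ∀ v : Fin n, v ≠ r → ∀ u : Fin n, nbr (off r + lab v) = u →
    G.dist u v + 1 = G.dist r v
  lab_min : ∀ v : Fin n, v ≠ r → ∀ j, off r + j < off (r + 1) → ∀ u : Fin n,
    nbr (off r + j) = u → G.dist u v + 1 = G.dist r v → lab v ≤ j

lemma BfsResult.labelled (h : IsAdjacencyArray G off nbr) (hG : G.Connected) {r : Fin n}
    {K : ℕ → ℕ} (hK : BfsResult n off nbr r K) :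
    ∃ lab, Labelled G off nbr r K lab := by
  have hL := h.listArray
  have hn : 0 < n := r.pos
  -- keys are realised by paths through some neighbour of the root
  have hA : ∀ N, ∀ v : Fin n, v ≠ r → K v ≠ 0 → K v ≤ N → ∃ j, ∃ u : Fin n, ∃ ℓ,
      off r + j < off (r + 1) ∧ nbr (off r + j) = u ∧ G.dist u v ≤ ℓ ∧
        K v = n * (ℓ + 2) + j := by
    intro N
    induction N with
    | zero => intro v hv h1 h2; omega
    | succ N ih =>
      intro v hv h1 h2
      rcases hK.parent v h1 with h3 | ⟨i, i1, i2, i3⟩ | ⟨v', h3, h4, ⟨i, i1, i2, i3⟩, h5⟩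
      · exact absurd (Fin.ext h3) hv
      · have hi : off r + (i - off r) = i := by omega
        have := hK.first (i - off r) (by omega)
        rw [hi, i3] at this
        exact ⟨i - off r, v, 0, by omega, by rw [hi, i3], by simp, by rw [this]; ring⟩
      · have hv' : v' < n := by
          by_contra hge
          have e1 : off v' = 0 ∨ v' = n := by
            rcases Nat.lt_or_ge n v' with h6 | h6
            · exact .inl (h.off_unused v' h6)
            · exact .inr (by omega)
          have e2 := h.off_unused (v' + 1) (by omega)
          omega
        obtain ⟨x, hx, hxe⟩ := h.exists_adj (v := ⟨v', hv'⟩) i1 i2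
        obtain rfl : x = v := Fin.ext (hxe.symm.trans i3)
        obtain ⟨j, u, ℓ, j1, j2, j3, j4⟩ := ih ⟨v', hv'⟩ (fun h => h3 (congrArg Fin.val h)) h4
          (by simp only; omega)
        refine ⟨j, u, ℓ + 1, j1, j2, ?_, ?_⟩
        · have := dist_le_succ hG hx u; omega
        · rw [h5, j4]; ring
  -- and no path gives a smaller key
  have hB : ∀ ℓ, ∀ v : Fin n, v ≠ r → ∀ j, off r + j < off (r + 1) → ∀ u : Fin n,
      nbr (off r + j) = u → G.dist u v ≤ ℓ → K v ≠ 0 ∧ K v ≤ n * (ℓ + 2) + j := by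
    intro ℓ
    induction ℓ with
    | zero =>
      intro v hv j hj u hu hd
      obtain rfl := hG.dist_eq_zero_iff.1 (Nat.le_zero.1 hd)
      have := hK.first j hj
      rw [hu] at this
      rw [this]; constructor <;> omega
    | succ ℓ ih =>
      intro v hv j hj u hu hd
      by_cases hd' : G.dist u v ≤ ℓ
      · have := ih v hv j hj u hu hd'
        refine ⟨this.1, this.2.trans ?_⟩
        gcongr; omega
      obtain ⟨p, hp⟩ := hG.exists_walk_length_eq_dist v u
      cases p with
      | nil => simp at hd'
      | @cons _ x _ hx p =>
        rw [SimpleGraph.Walk.length_cons, SimpleGraph.dist_comm] at hp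
        have hxd : G.dist u x ≤ ℓ := by
          rw [SimpleGraph.dist_comm]
          exact (SimpleGraph.dist_le p).trans (by omega)
        obtain ⟨i, i1, i2, i3⟩ := h.exists_index hx.symm
        by_cases hxr : x = r
        · subst hxr
          have := hK.first (i - off x) (by omega)
          rw [show off x + (i - off x) = i by omega, i3] at this
          have hdeg := hL.degree_le x.2
          have h3 : n * 3 ≤ n * (ℓ + 1 + 2) := Nat.mul_le_mul_left _ (by omega)
          rw [this]; constructor <;> omega
        · have h2 := ih x hxr j hj u hu hxd
          have h3 := hK.edge x (fun h => hxr (Fin.ext h)) h2.1 v ⟨i, i1, i2, i3⟩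
          refine ⟨h3.1, h3.2.trans ?_⟩
          calc K x + n ≤ n * (ℓ + 2) + j + n := by omega
            _ = n * (ℓ + 1 + 2) + j := by ring
  have key : ∀ v : Fin n, ∃ l, K v = n * (G.dist r v + 1) + l ∧ l < n ∧ (v ≠ r →
      off r + l < off (r + 1) ∧
      (∀ u : Fin n, nbr (off r + l) = u → G.dist u v + 1 = G.dist r v) ∧
      ∀ j, off r + j < off (r + 1) → ∀ u : Fin n,
        nbr (off r + j) = u → G.dist u v + 1 = G.dist r v → l ≤ j) := by
    intro v
    by_cases hv : v = r
    · subst hv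
      exact ⟨0, by simp [hK.root], hn, fun h => absurd rfl h⟩
    obtain ⟨p, hp⟩ := hG.exists_walk_length_eq_dist r v
    cases p with
    | nil => exact absurd rfl hv
    | @cons _ x _ hx p =>
      rw [SimpleGraph.Walk.length_cons] at hp
      have hpd := SimpleGraph.dist_le p
      obtain ⟨i, i1, i2, i3⟩ := h.exists_index hx
      obtain ⟨b1, b2⟩ := hB _ v hv (i - off r) (by omega) x
        (by rw [show off r + (i - off r) = i by omega, i3]) le_rfl
      obtain ⟨j, u, ℓ, j1, j2, j3, j4⟩ := hA _ v hv b1 le_rfl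
      have hdeg := hL.degree_le r.2
      obtain ⟨u', hu', e⟩ := h.exists_adj (v := r) (i := off r + j) (by omega) j1
      obtain rfl : u' = u := Fin.ext (e.symm.trans j2)
      have htri := hG.dist_triangle (u := r) (v := u') (w := v)
      rw [SimpleGraph.dist_eq_one_iff_adj.2 hu'] at htri
      have hℓ : ℓ + 1 = G.dist r v := by
        refine le_antisymm ?_ (by omega)
        have h1 : n * (ℓ + 2) < n * (G.dist x v + 3) := by
          rw [j4] at b2
          have : n * (G.dist x v + 3) = n * (G.dist x v + 2) + n := by ring
          omega
        have := Nat.lt_of_mul_lt_mul_left h1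
        omega
      refine ⟨j, by rw [j4, ← hℓ], by omega, fun _ => ⟨j1, fun y hy => ?_, fun j' k1 y k2 k3 => ?_⟩⟩
      · obtain rfl : u' = y := Fin.ext (j2.symm.trans hy)
        omega
      · have := (hB _ v hv j' k1 y k2 le_rfl).2
        rw [j4, show ℓ = G.dist y v by omega] at this
        omega
  choose l hl using key
  have hlv : ∀ v : Fin n, (if hv : (v : ℕ) < n then l ⟨v, hv⟩ else 0) = l v := fun v => by simp
  refine ⟨fun v => if hv : v < n then l ⟨v, hv⟩ else 0, ?_, ?_, ?_, ?_, ?_⟩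
  · intro v; simp only [hlv]; exact (hl v).1
  · intro v; simp only [hlv]; exact (hl v).2.1
  · intro v hv; simp only [hlv]; exact ((hl v).2.2 hv).1
  · intro v hv; simp only [hlv]; exact ((hl v).2.2 hv).2.1
  · intro v hv; simp only [hlv]; exact ((hl v).2.2 hv).2.2

lemma Labelled.div_eq {r : Fin n} {K lab : ℕ → ℕ} (h : Labelled G off nbr r K lab) (v : Fin n) :
    K v / n = G.dist r v + 1 := by
  rw [h.key, Nat.mul_add_div r.pos, Nat.div_eq_of_lt (h.lab_lt v), add_zero]

lemma Labelled.sum_eq {r : Fin n} {K lab : ℕ → ℕ} (h : Labelled G off nbr r K lab) :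
    ∑ v ∈ Finset.range n, (K v / n - 1) = closeness G r := by
  rw [Finset.sum_range]
  exact Finset.sum_congr rfl fun v _ => by rw [h.div_eq]; omega

end Bridge

/-! ### Tabulating the gains of the candidates -/

section Tally

/-- Registers `22` and `23` get the centralities of `a` and `b` after adding the edge `ab`; cell `j`
of array `9` gets the number of vertices that are closer to `b`, differ from `b`, and have label `j`
in the search from `b`. The keys of the searches from `a` and `b` are in the arrays `7` and `8`. -/
def tally : Prog :=
  .assign 22 (.const 0) ;;
  .assign 23 (.const 0) ;;
  .assign 27 (.const 0) ;;
  .loop (.bin .lt (.reg 27) (.reg 0)) (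
    .assign 28 (.bin .div (.get 7 (.reg 27)) (.reg 0)) ;;
    .assign 29 (.bin .div (.get 8 (.reg 27)) (.reg 0)) ;;
    .ite (.bin .lt (.reg 29) (.reg 28)) (
      .assign 22 (.bin .add (.reg 22) (.reg 29)) ;;
      .assign 30 (.bin .sub (.get 8 (.reg 27)) (.bin .mul (.reg 29) (.reg 0))) ;;
      .store 9 (.reg 30) (.bin .add (.get 9 (.reg 30)) (.bin .lt (.const 1) (.reg 29))))
      (.assign 22 (.bin .add (.reg 22) (.bin .sub (.reg 28) (.const 1)))) ;;
    .ite (.bin .lt (.reg 28) (.reg 29))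
      (.assign 23 (.bin .add (.reg 23) (.reg 28)))
      (.assign 23 (.bin .add (.reg 23) (.bin .sub (.reg 29) (.const 1)))) ;;
    .assign 27 (.bin .add (.reg 27) (.const 1)))

/-- The registers and arrays that `tally` leaves alone. -/
def TallyFrame (s s' : State) : Prop :=
  (∀ x, x < 22 → s'.reg x = s.reg x) ∧ ∀ A, A ≠ 9 → s'.mem A = s.mem A

lemma TallyFrame.setReg {s s' : State} (h : TallyFrame s s') {x : ℕ} (v : ℕ) (hx : 22 ≤ x) :
    TallyFrame s (s'.setReg x v) := by
  refine ⟨fun y hy => ?_, h.2⟩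
  rw [State.setReg_reg, if_neg (by omega)]
  exact h.1 y hy

lemma TallyFrame.setMem {s s' : State} (h : TallyFrame s s') (i v : ℕ) :
    TallyFrame s (s'.setMem 9 i v) := by
  refine ⟨h.1, fun B hB => ?_⟩
  rw [State.setMem_mem, if_neg hB]
  exact h.2 B hB

/-- The distance of `v` from `a` after adding `ab`, in terms of `x = d(a, v) + 1` and
`y = d(b, v) + 1`. -/
def joinDist (x y : ℕ) : ℕ := if y < x then y else x - 1

variable {n w : ℕ}

lemma wp_tally {s : State} (hn : 0 < n) (hs0 : s.reg 0 = n) (h9 : ∀ j, s.mem 9 j = 0)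
    (h7 : ∀ v, s.mem 7 v ≤ 3 * n + n * n) (h8 : ∀ v, s.mem 8 v ≤ 3 * n + n * n)
    (hM : 4 * (n * n) + 8 * n + 8 ≤ 2 ^ w) :
    Wp w tally s fun t s' => t ≤ 60 * n + 20 ∧ (TallyFrame s s' ∧
      s'.reg 22 = ∑ v ∈ Finset.range n, joinDist (s.mem 7 v / n) (s.mem 8 v / n) ∧
      s'.reg 23 = ∑ v ∈ Finset.range n, joinDist (s.mem 8 v / n) (s.mem 7 v / n) ∧
      ∀ j, s'.mem 9 j = ∑ v ∈ Finset.range n,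
        if s.mem 8 v / n < s.mem 7 v / n ∧ 1 < s.mem 8 v / n ∧
          s.mem 8 v - s.mem 8 v / n * n = j then 1 else 0) := by
  have c1 : 1 % 2 ^ w = 1 := Nat.mod_eq_of_lt (by omega)
  have c0 : 0 % 2 ^ w = 0 := Nat.zero_mod _
  have hbound : ∀ x, x ≤ 3 * n + n * n → x / n ≤ n + 3 := by
    intro x hx
    have h1 : x / n ≤ (n * (n + 3)) / n := Nat.div_le_div_right (by rw [Nat.mul_add]; omega)
    rwa [Nat.mul_div_cancel_left _ hn] at h1
  have hsum : ∀ f g : ℕ → ℕ, (∀ v, f v ≤ n + 3) → (∀ v, g v ≤ n + 3) → ∀ m ≤ n,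
      ∑ v ∈ Finset.range m, joinDist (f v) (g v) ≤ n * n + 3 * n := by
    intro f g hf hg m hm
    calc _ ≤ ∑ v ∈ Finset.range m, (n + 3) := Finset.sum_le_sum fun v _ => by
          have := hf v
          have := hg v
          unfold joinDist
          split_ifs <;> omega
      _ = m * (n + 3) := by simp
      _ ≤ n * (n + 3) := Nat.mul_le_mul_right _ hm
      _ = _ := by ring
  unfold tally
  simp only [wp_seq, wp_assign, Expr.eval, Expr.cost, c0]
  refine (wp_loop (fun T s' => ∃ i, i ≤ n ∧ TallyFrame s s' ∧ s'.reg 27 = i ∧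
      s'.reg 22 = ∑ v ∈ Finset.range i, joinDist (s.mem 7 v / n) (s.mem 8 v / n) ∧
      s'.reg 23 = ∑ v ∈ Finset.range i, joinDist (s.mem 8 v / n) (s.mem 7 v / n) ∧
      (∀ j, s'.mem 9 j = ∑ v ∈ Finset.range i,
        if s.mem 8 v / n < s.mem 7 v / n ∧ 1 < s.mem 8 v / n ∧
          s.mem 8 v - s.mem 8 v / n * n = j then 1 else 0) ∧
      60 * (n - i) + 4 ≤ T)
    (R := fun s' => TallyFrame s s' ∧
      s'.reg 22 = ∑ v ∈ Finset.range n, joinDist (s.mem 7 v / n) (s.mem 8 v / n) ∧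
      s'.reg 23 = ∑ v ∈ Finset.range n, joinDist (s.mem 8 v / n) (s.mem 7 v / n) ∧
      ∀ j, s'.mem 9 j = ∑ v ∈ Finset.range n,
        if s.mem 8 v / n < s.mem 7 v / n ∧ 1 < s.mem 8 v / n ∧
          s.mem 8 v - s.mem 8 v / n * n = j then 1 else 0)
    ?_ ?_ (60 * n + 4) _ ?_).mono ?_
  · rintro T s' ⟨i, hi, hf, f27, f22, f23, f9, hT⟩ he
    have f0 := (hf.1 0 (by omega)).trans hs0
    simp only [Expr.eval, Expr.cost, Op.apply, f27, f0] at he ⊢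
    obtain rfl : i = n := by
      by_contra hne
      rw [if_pos (by omega)] at he
      omega
    exact ⟨by omega, hf, f22, f23, f9⟩
  · rintro T s' ⟨i, hi, hf, f27, f22, f23, f9, hT⟩ he
    have f0 := (hf.1 0 (by omega)).trans hs0
    simp only [Expr.eval, Op.apply, f27, f0, ne_eq, ite_eq_right_iff, not_forall] at he
    obtain ⟨hlt, -⟩ := he
    have hA := hsum (fun v => s.mem 7 v / n) (fun v => s.mem 8 v / n)
      (fun v => hbound _ (h7 v)) (fun v => hbound _ (h8 v)) (i + 1) hlt
    have hB := hsum (fun v => s.mem 8 v / n) (fun v => s.mem 7 v / n)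
      (fun v => hbound _ (h8 v)) (fun v => hbound _ (h7 v)) (i + 1) hlt
    have hC : ∀ j, s'.mem 9 j ≤ n := by
      intro j
      rw [f9]
      calc _ ≤ ∑ v ∈ Finset.range i, 1 := Finset.sum_le_sum fun v _ => by split_ifs <;> omega
        _ ≤ n := by simpa using hi
    have f7 : s'.mem 7 = s.mem 7 := hf.2 7 (by omega)
    have f8 : s'.mem 8 = s.mem 8 := hf.2 8 (by omega)
    have d1 : (i + 1) % 2 ^ w = i + 1 := Nat.mod_eq_of_lt (by omega)
    have d2 : s.mem 8 i / n * n % 2 ^ w = s.mem 8 i / n * n := Nat.mod_eq_of_lt (by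
      have := Nat.div_mul_le_self (s.mem 8 i) n
      have := h8 i
      omega)
    have d3 : ∀ j, (s'.mem 9 j + if 1 < s.mem 8 i / n then 1 else 0) % 2 ^ w =
        s'.mem 9 j + if 1 < s.mem 8 i / n then 1 else 0 := fun j => Nat.mod_eq_of_lt (by
      have := hC j
      split_ifs <;> omega)
    simp only [Finset.sum_range_succ, ← f22, ← f23] at hA hB
    have e22 : ∀ x, x = joinDist (s.mem 7 i / n) (s.mem 8 i / n) →
        (s'.reg 22 + x) % 2 ^ w = s'.reg 22 + x := by
      rintro x rfl; exact Nat.mod_eq_of_lt (by omega)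
    have e23 : ∀ x, x = joinDist (s.mem 8 i / n) (s.mem 7 i / n) →
        (s'.reg 23 + x) % 2 ^ w = s'.reg 23 + x := by
      rintro x rfl; exact Nat.mod_eq_of_lt (by omega)
    simp only [wp_seq, wp_assign, wp_store, wp_ite, Expr.eval, Expr.cost, Op.apply,
      State.setReg_reg, State.setReg_mem, State.setMem_reg, State.setMem_mem, Nat.reduceEqDiff,
      reduceIte, c1, f0, f7, f8, f27, d1, d2, d3]
    have frame1 : ∀ x y, TallyFrame s ((s'.setReg 28 x).setReg 29 y) :=
      fun x y => (hf.setReg _ (by omega)).setReg _ (by omega)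
    by_cases hyx : s.mem 8 i / n < s.mem 7 i / n
    · have j1 : joinDist (s.mem 7 i / n) (s.mem 8 i / n) = s.mem 8 i / n := if_pos hyx
      have j2 : joinDist (s.mem 8 i / n) (s.mem 7 i / n) = s.mem 8 i / n - 1 := if_neg (by omega)
      have hxy : ¬ s.mem 7 i / n < s.mem 8 i / n := by omega
      simp only [hyx, hxy, reduceIte, ne_eq, one_ne_zero, not_false_eq_true, not_true_eq_false,
        forall_const, IsEmpty.forall_iff, and_true, true_and, e22 _ j1.symm, e23 _ j2.symm]
      refine ⟨60 * (n - (i + 1)) + 4, by omega, i + 1, hlt, ?_, rfl, ?_, ?_, fun j => ?_, le_rfl⟩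
      · exact (((((frame1 _ _).setReg _ (by omega)).setReg _ (by omega)).setMem _ _).setReg _
          (by omega)).setReg _ (by omega)
      · rw [Finset.sum_range_succ, j1, f22]
      · rw [Finset.sum_range_succ, j2, f23]
      · rw [Finset.sum_range_succ, ← f9, Function.update_apply]
        by_cases hj : s.mem 8 i - s.mem 8 i / n * n = j
        · rw [if_pos hj.symm, hj]; simp [hyx]
        · rw [if_neg (Ne.symm hj), if_neg (by tauto)]; rfl
    · have j1 : joinDist (s.mem 7 i / n) (s.mem 8 i / n) = s.mem 7 i / n - 1 := if_neg hyx
      have frame2 : ∀ x y z u v, TallyFrame s (((((s'.setReg 28 x).setReg 29 y).setReg 22 z).setReg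
          23 u).setReg 27 v) := fun x y z u v =>
        (((frame1 _ _).setReg _ (by omega)).setReg _ (by omega)).setReg _ (by omega)
      have hcount : ∀ j, s'.mem 9 j = ∑ v ∈ Finset.range (i + 1),
          if s.mem 8 v / n < s.mem 7 v / n ∧ 1 < s.mem 8 v / n ∧
            s.mem 8 v - s.mem 8 v / n * n = j then 1 else 0 := fun j => by
        rw [Finset.sum_range_succ, ← f9, if_neg (by tauto)]; rfl
      by_cases hxy : s.mem 7 i / n < s.mem 8 i / n
      · have j2 : joinDist (s.mem 8 i / n) (s.mem 7 i / n) = s.mem 7 i / n := if_pos hxy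
        simp only [hyx, hxy, reduceIte, ne_eq, one_ne_zero, not_false_eq_true, not_true_eq_false,
          forall_const, IsEmpty.forall_iff, and_true, true_and, e22 _ j1.symm, e23 _ j2.symm]
        refine ⟨60 * (n - (i + 1)) + 4, by omega, i + 1, hlt, frame2 _ _ _ _ _, rfl, ?_, ?_,
          hcount, le_rfl⟩
        · rw [Finset.sum_range_succ, j1, f22]
        · rw [Finset.sum_range_succ, j2, f23]
      · have j2 : joinDist (s.mem 8 i / n) (s.mem 7 i / n) = s.mem 8 i / n - 1 := if_neg hxy
        simp only [hyx, hxy, reduceIte, ne_eq, not_true_eq_false,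
          forall_const, IsEmpty.forall_iff, true_and, e22 _ j1.symm, e23 _ j2.symm]
        refine ⟨60 * (n - (i + 1)) + 4, by omega, i + 1, hlt, frame2 _ _ _ _ _, rfl, ?_, ?_,
          hcount, le_rfl⟩
        · rw [Finset.sum_range_succ, j1, f22]
        · rw [Finset.sum_range_succ, j2, f23]
  · refine ⟨0, Nat.zero_le _, ?_, by simp, by simp, by simp, by simp [h9], le_rfl⟩
    exact ((TallyFrame.setReg ⟨fun _ _ => rfl, fun _ _ => rfl⟩ _ (by omega)).setReg _
      (by omega)).setReg _ (by omega)
  · rintro t s' ⟨h1, h2⟩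
    exact ⟨by omega, h2⟩

end Tally

/-! ### Selecting the edges -/

section Select

/-- Put `S = {ab}` if `ab` is not an edge, and stop with the better of `S` and `∅` if this makes
the centralities cross. Registers: `13` is the size of `S`, `20` and `21` are the centralities of
`a` and `b` in `G`, `22` and `23` those in `G + S`; register `24` tells whether the search is
over; `25` is the position in the list of `b`, which starts at `26`. -/
def selectInit : Prog :=
  .assign 13 (.const 0) ;;
  .assign 24 (.const 0) ;;
  .assign 25 (.const 0) ;;
  .assign 26 (.get 0 (.reg 2)) ;;
  .ite (.bin .eq (.bin .div (.get 7 (.reg 2)) (.reg 0)) (.const 2)) .skip (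
    .store 2 (.const 0) (.reg 1) ;;
    .store 3 (.const 0) (.reg 2) ;;
    .assign 13 (.const 1)) ;;
  .ite (.bin .lt (.reg 23) (.reg 22)) .skip (
    .assign 24 (.const 1) ;;
    .ite (.bin .lt (.bin .mul (.reg 22) (.reg 20)) (.bin .mul (.reg 21) (.reg 23)))
      (.assign 13 (.const 0)) .skip)

/-- The loop of the algorithm, with the candidates in the order of the list of `b`. -/
def selectLoop : Prog :=
  .loop (.bin .eq (.reg 24) (.const 0)) (
    .ite (.bin .lt (.reg 13) (.reg 3)) (
      .assign 10 (.get 1 (.bin .add (.reg 26) (.reg 25))) ;;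
      .ite (.bin .lt (.const 2) (.bin .div (.get 7 (.reg 10)) (.reg 0))) (
        .store 2 (.reg 13) (.reg 1) ;;
        .store 3 (.reg 13) (.reg 10) ;;
        .assign 13 (.bin .add (.reg 13) (.const 1)) ;;
        .assign 30 (.bin .sub (.reg 22) (.get 9 (.reg 25))) ;;
        .ite (.bin .lt (.reg 23) (.reg 30)) .skip (
          .assign 24 (.const 1) ;;
          .ite (.bin .lt (.bin .mul (.reg 30) (.reg 22)) (.bin .mul (.reg 23) (.reg 23)))
            (.assign 13 (.bin .sub (.reg 13) (.const 1))) .skip) ;;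
        .assign 22 (.reg 30))
        .skip ;;
      .assign 25 (.bin .add (.reg 25) (.const 1)))
      (.assign 24 (.const 1) ;;
      .ite (.bin .lt (.bin .mul (.reg 23) (.reg 20)) (.bin .mul (.reg 21) (.reg 22)))
        (.assign 13 (.const 0)) .skip))

variable {n : ℕ} {G : SimpleGraph (Fin n)} {a b : Fin n} {k : ℕ} {off nbr : ℕ → ℕ} {w : ℕ}

/-- The first `m` cells of the arrays `2` and `3` list the members of `S`. -/
def Lists (s : State) (m : ℕ) (S : Finset (Sym2 (Fin n))) : Prop :=
  Set.BijOn (fun i => s(s.mem 2 i, s.mem 3 i)) (Set.Iio m)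
    (Sym2.map Fin.val '' (S : Set (Sym2 (Fin n))))

lemma Lists.zero (s : State) : Lists s 0 (∅ : Finset (Sym2 (Fin n))) := by
  simp [Lists]

lemma Lists.congr {s s' : State} {m : ℕ} {S : Finset (Sym2 (Fin n))} (h : Lists s m S)
    (h2 : ∀ i < m, s'.mem 2 i = s.mem 2 i) (h3 : ∀ i < m, s'.mem 3 i = s.mem 3 i) :
    Lists s' m S := by
  refine Set.BijOn.congr h fun i hi => ?_
  rw [h2 i hi, h3 i hi]

lemma Lists.insert {s s' : State} {m : ℕ} {S : Finset (Sym2 (Fin n))} {x y : Fin n}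
    (h : Lists s m S) (hxy : s(x, y) ∉ S) (h2 : s'.mem 2 = Function.update (s.mem 2) m x)
    (h3 : s'.mem 3 = Function.update (s.mem 3) m y) : Lists s' (m + 1) (insert s(x, y) S) := by
  have h1 : Lists s' m S := h.congr (fun i hi => by rw [h2, Function.update_of_ne (by omega)])
    (fun i hi => by rw [h3, Function.update_of_ne (by omega)])
  have hm : (fun i => s(s'.mem 2 i, s'.mem 3 i)) m = Sym2.map Fin.val s(x, y) := by
    simp [h2, h3]
  unfold Lists
  rw [← Order.succ_eq_add_one, Order.Iio_succ_eq_insert, Finset.coe_insert, Set.image_insert_eq,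
    ← hm]
  refine Set.BijOn.insert h1 ?_
  rw [show s(s'.mem 2 m, s'.mem 3 m) = _ from hm]
  rintro ⟨e, he, hee⟩
  rw [Sym2.map.injective Fin.val_injective hee] at he
  exact hxy he

open Classical in
/-- The number of vertices `v ≠ b` that are closer to `b` than to `a` and have label `j`. By
`closeness_insert_add_drop`, their distance from `a` drops by one when the `j`-th entry of the
list of `b` is joined to `a` after all earlier candidates. -/
noncomputable def drop (G : SimpleGraph (Fin n)) (a b : Fin n) (lab : ℕ → ℕ) (j : ℕ) : ℕ :=
  ∑ v : Fin n, if G.dist b v < G.dist a v ∧ 0 < G.dist b v ∧ lab v = j then 1 else 0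

/-- `W` consists of the candidates among the first `j` entries of the list of `b`. -/
def FirstCandidates (G : SimpleGraph (Fin n)) (a b : Fin n) (off nbr : ℕ → ℕ) (j : ℕ)
    (W : Finset (Fin n)) : Prop :=
  ∀ u, u ∈ W ↔ Candidate G a b u ∧ ∃ i < j, nbr (off b + i) = u

lemma starDist_eq (hA : IsAdjacencyArray G off nbr) (hG : G.Connected) {K lab : ℕ → ℕ}
    (hK : Labelled G off nbr b K lab) {j : ℕ} {W : Finset (Fin n)}
    (hj : off b + j ≤ off (b + 1)) (hW : FirstCandidates G a b off nbr j W) (v : Fin n) :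
    starDist G a b W v = if G.dist b v < G.dist a v ∧ 0 < G.dist b v ∧ lab v < j then G.dist b v
      else min (G.dist a v) (G.dist b v + 1) := by
  suffices h : (G.dist b v < G.dist a v ∧ ∃ u ∈ W, G.dist u v + 1 = G.dist b v) ↔
      (G.dist b v < G.dist a v ∧ 0 < G.dist b v ∧ lab v < j) by
    unfold starDist
    by_cases h' : G.dist b v < G.dist a v ∧ 0 < G.dist b v ∧ lab v < j
    · rw [if_pos (h.2 h'), if_pos h']
    · rw [if_neg (h'.imp h.1), if_neg h']
  refine and_congr_right fun hlt => ?_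
  constructor
  · rintro ⟨u, hu, hd⟩
    obtain ⟨-, i, hi, he⟩ := (hW u).1 hu
    refine ⟨by omega, lt_of_le_of_lt (hK.lab_min v ?_ i (by omega) u he hd) hi⟩
    rintro rfl
    simp at hd
  · rintro ⟨hpos, hl⟩
    have hv : v ≠ b := by rintro rfl; simp at hpos
    obtain ⟨u, hu, he⟩ := hA.exists_adj (v := b) (i := off b + lab v) (by omega)
      (hK.lab_mem v hv)
    have hd := hK.lab_dist v hv u he
    refine ⟨u, (hW u).2 ⟨⟨hu, ?_, fun hau => ?_⟩, lab v, hl, he⟩, hd⟩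
    · rintro rfl; omega
    · have := hG.dist_triangle (u := a) (v := u) (w := v)
      rw [SimpleGraph.dist_eq_one_iff_adj.2 hau] at this
      omega

lemma closeness_insert_add_drop (hA : IsAdjacencyArray G off nbr) (hG : G.Connected)
    (hab : a ≠ b) {K lab : ℕ → ℕ} (hK : Labelled G off nbr b K lab) {j : ℕ} {W : Finset (Fin n)}
    (hj : off b + j < off (b + 1)) (hW : FirstCandidates G a b off nbr j W)
    {S : Finset (Sym2 (Fin n))} (hS : StarSet G a b S W) {u : Fin n} (hu : Candidate G a b u)
    (hW' : FirstCandidates G a b off nbr (j + 1) (insert u W)) :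
    closeness (addEdges G (insert s(a, u) S)) a + drop G a b lab j =
      closeness (addEdges G S) a := by
  classical
  rw [(hS.insert hu).closeness_left hG hab, hS.closeness_left hG hab, drop,
    ← Finset.sum_add_distrib]
  refine Finset.sum_congr rfl fun v _ => ?_
  rw [starDist_eq hA hG hK hj hW', starDist_eq hA hG hK hj.le hW]
  split_ifs <;> omega

lemma FirstCandidates.insert {j : ℕ} {W : Finset (Fin n)}
    (hW : FirstCandidates G a b off nbr j W) {u : Fin n} (hu : Candidate G a b u)
    (he : nbr (off b + j) = u) : FirstCandidates G a b off nbr (j + 1) (insert u W) := by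
  intro v
  rw [Finset.mem_insert, hW]
  constructor
  · rintro (rfl | ⟨h1, i, hi, h2⟩)
    · exact ⟨hu, j, by omega, he⟩
    · exact ⟨h1, i, by omega, h2⟩
  · rintro ⟨h1, i, hi, h2⟩
    rcases Nat.lt_succ_iff_lt_or_eq.1 hi with hi | rfl
    · exact .inr ⟨h1, i, hi, h2⟩
    · exact .inl (Fin.ext (h2.symm.trans he))

lemma FirstCandidates.skip {j : ℕ} {W : Finset (Fin n)}
    (hW : FirstCandidates G a b off nbr j W) {u : Fin n} (hu : ¬ Candidate G a b u)
    (he : nbr (off b + j) = u) : FirstCandidates G a b off nbr (j + 1) W := by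
  intro v
  rw [hW]
  refine and_congr_right fun hv => ⟨fun ⟨i, hi, h2⟩ => ⟨i, by omega, h2⟩, fun ⟨i, hi, h2⟩ => ?_⟩
  rcases Nat.lt_succ_iff_lt_or_eq.1 hi with hi | rfl
  · exact ⟨i, hi, h2⟩
  · exact absurd ((Fin.ext (h2.symm.trans he) : v = u) ▸ hv) hu

lemma candidate_iff_dist (hG : G.Connected) {u : Fin n} (hu : G.Adj b u) :
    Candidate G a b u ↔ 2 < G.dist a u + 1 := by
  constructor
  · intro h
    have := h.two_le_dist hG
    omega
  · intro h
    refine ⟨hu, ?_, fun hau => ?_⟩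
    · rintro rfl; simp at h
    · rw [SimpleGraph.dist_eq_one_iff_adj.2 hau] at h; omega

lemma dist_le_of_connected (hG : G.Connected) (x y : Fin n) : G.dist x y ≤ n := by
  obtain ⟨p, hp, hl⟩ := hG.exists_path_of_dist x y
  rw [← hl]
  simpa using hp.length_lt.le

lemma closeness_addEdges_le (hG : G.Connected) (S : Finset (Sym2 (Fin n))) (v : Fin n) :
    closeness (addEdges G S) v ≤ n * n := by
  calc _ ≤ ∑ u : Fin n, n := Finset.sum_le_sum fun u _ =>
        dist_le_of_connected (addEdges_connected hG S) v u
    _ = n * n := by simp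

lemma isBetterOf_left {A B A' B' : ℕ} {S T : Finset (Sym2 (Fin n))}
    (hS : ratio (addEdges G S) a b = A / B) (hT : ratio (addEdges G T) a b = A' / B')
    (hB : 0 < B) (hB' : 0 < B') (h : ¬ A * B' < A' * B) : IsBetterOf G a b S T S := by
  refine .inl ⟨rfl, ?_⟩
  rw [hS, hT, div_le_div_iff₀ (by positivity) (by positivity)]
  exact_mod_cast not_lt.1 h

lemma isBetterOf_right {A B A' B' : ℕ} {S T : Finset (Sym2 (Fin n))}
    (hS : ratio (addEdges G S) a b = A / B) (hT : ratio (addEdges G T) a b = A' / B')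
    (hB : 0 < B) (hB' : 0 < B') (h : A * B' < A' * B) : IsBetterOf G a b S T T := by
  refine .inr ⟨rfl, ?_⟩
  rw [hS, hT, div_le_div_iff₀ (by positivity) (by positivity)]
  exact_mod_cast h.le

/-- The contents of registers and arrays that do not change while the edges are selected. -/
structure Fixed (G : SimpleGraph (Fin n)) (a b : Fin n) (k : ℕ) (off nbr lab : ℕ → ℕ) (s : State) :
    Prop where
  reg_0 : s.reg 0 = n
  reg_1 : s.reg 1 = a
  reg_2 : s.reg 2 = b
  reg_3 : s.reg 3 = k
  reg_20 : s.reg 20 = closeness G a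
  reg_21 : s.reg 21 = closeness G b
  mem_0 : s.mem 0 = off
  mem_1 : s.mem 1 = nbr
  mem_7 : ∀ v : Fin n, s.mem 7 v / n = G.dist a v + 1
  mem_9 : ∀ j, s.mem 9 j = drop G a b lab j

lemma Fixed.setReg {lab : ℕ → ℕ} {s : State} (h : Fixed G a b k off nbr lab s) {x : ℕ} (v : ℕ)
    (hx : (4 ≤ x ∧ x < 20) ∨ 22 ≤ x) : Fixed G a b k off nbr lab (s.setReg x v) := by
  have hr : ∀ y, (y < 4 ∨ (20 ≤ y ∧ y < 22)) → (s.setReg x v).reg y = s.reg y := by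
    intro y hy
    rw [State.setReg_reg, if_neg (by omega)]
  obtain ⟨h0, h1, h2, h3, h20, h21, m0, m1, m7, m9⟩ := h
  refine ⟨?_, ?_, ?_, ?_, ?_, ?_, m0, m1, m7, m9⟩ <;> rw [hr _ (by omega)] <;> assumption

lemma Fixed.setMem {lab : ℕ → ℕ} {s : State} (h : Fixed G a b k off nbr lab s) {A : ℕ} (i v : ℕ)
    (hA : A = 2 ∨ A = 3) : Fixed G a b k off nbr lab (s.setMem A i v) := by
  have hr : ∀ B, B ≠ 2 → B ≠ 3 → (s.setMem A i v).mem B = s.mem B := by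
    intro B h2 h3
    rw [State.setMem_mem, if_neg (by omega)]
  obtain ⟨h0, h1, h2, h3, h20, h21, m0, m1, m7, m9⟩ := h
  refine ⟨h0, h1, h2, h3, h20, h21, ?_, ?_, ?_, ?_⟩ <;> rw [hr _ (by omega) (by omega)] <;>
    assumption

/-- The state when the head of the loop has been reached with the set `S`, and the first `j` entries
of the list of `b` have been considered. -/
def AtHead (G : SimpleGraph (Fin n)) (a b : Fin n) (k : ℕ) (off nbr : ℕ → ℕ) (j : ℕ)
    (s : State) : Prop :=
  ∃ S W, Reachable G a b k (.head S) ∧ StarSet G a b S W ∧ FirstCandidates G a b off nbr j W ∧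
    Lists s S.card S ∧ ¬ Crossed G a b S ∧ off b + j ≤ off (b + 1) ∧ s.reg 13 = S.card ∧
    s.reg 22 = closeness (addEdges G S) a ∧ s.reg 23 = closeness (addEdges G S) b ∧
    s.reg 24 = 0 ∧ s.reg 25 = j ∧ s.reg 26 = off b

/-- The state when a set has been returned. -/
def AtEnd (G : SimpleGraph (Fin n)) (a b : Fin n) (k : ℕ) (s : State) : Prop :=
  s.reg 24 = 1 ∧ ∃ S, Returns G a b k S ∧ Lists s (s.reg 13) S

lemma wp_selectInit {lab : ℕ → ℕ} {s : State} (hG : G.Connected)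
    (hc : closeness G b < closeness G a)
    (hM : n * n * (n * n) < 2 ^ w) (hM2 : 3 ≤ 2 ^ w) (hA : IsAdjacencyArray G off nbr)
    (hF : Fixed G a b k off nbr lab s)
    (h22 : s.reg 22 = nearSum G a b + closer G b a)
    (h23 : s.reg 23 = nearSum G a b + closer G a b) :
    Wp w selectInit s fun t s' => t ≤ 60 ∧ Fixed G a b k off nbr lab s' ∧
      (AtHead G a b k off nbr 0 s' ∨ AtEnd G a b k s') := by
  have hab : a ≠ b := by rintro rfl; exact hc.ne rfl
  have c0 : 0 % 2 ^ w = 0 := Nat.zero_mod _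
  have c1 : 1 % 2 ^ w = 1 := Nat.mod_eq_of_lt (by omega)
  have c2 : 2 % 2 ^ w = 2 := Nat.mod_eq_of_lt (by omega)
  have hmul : ∀ {x y : ℕ}, x ≤ n * n → y ≤ n * n → x * y % 2 ^ w = x * y := fun hx hy =>
    Nat.mod_eq_of_lt ((Nat.mul_le_mul hx hy).trans_lt hM)
  have hle : ∀ v, closeness G v ≤ n * n := fun v => by
    simpa using closeness_addEdges_le hG ∅ v
  have hW0 : FirstCandidates G a b off nbr 0 ∅ := by intro u; simp
  have hoff := hA.off_le b b.2
  have hadj : G.dist a b + 1 = 2 ↔ G.Adj a b := by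
    rw [← SimpleGraph.dist_eq_one_iff_adj]; omega
  unfold selectInit
  by_cases hab' : G.Adj a b
  · have hst := starSet_empty (G := G) hab'
    have e2 := hst.closeness_left_empty hG hab
    have e1 := hst.closeness_right hG hab
    rw [addEdges_empty] at e1 e2
    have hlt : nearSum G a b + closer G a b < nearSum G a b + closer G b a := by omega
    simp only [wp_seq, wp_assign, wp_ite, wp_skip, Expr.eval, Expr.cost, Op.apply,
      State.setReg_reg, State.setReg_mem, Nat.reduceEqDiff, reduceIte, c0, c1, c2,
      hF.reg_0, hF.reg_2, hF.mem_0, hF.mem_7, hadj, hab', h22, h23, hlt, ne_eq, one_ne_zero,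
      not_false_eq_true, forall_const, IsEmpty.forall_iff, and_true]
    refine ⟨by omega, ?_, .inl ?_⟩
    · exact (((hF.setReg _ (by omega)).setReg _ (by omega)).setReg _ (by omega)).setReg _ (by omega)
    · refine ⟨∅, ∅, .single (.startAdj hab'), hst, hW0, ?_, ?_, by omega, ?_⟩
      · simpa using Lists.zero _
      · simpa [Crossed] using hc
      · simp [h22, h23, e1, e2]
  · have hst := starSet_singleton (G := G) hab'
    have e2 := hst.closeness_left_empty hG hab
    have e1 := hst.closeness_right hG hab
    have hH := addEdges_connected hG {s(a, b)}
    rw [← e2] at h22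
    rw [← e1] at h23
    have hl1 := closeness_addEdges_le hG {s(a, b)} a
    have hl2 := closeness_addEdges_le hG {s(a, b)} b
    have hlist : ∀ s' : State, s'.mem 2 = Function.update (s.mem 2) 0 a →
        s'.mem 3 = Function.update (s.mem 3) 0 b → Lists s' 1 {s(a, b)} := fun s' g2 g3 => by
      simpa using (Lists.zero (n := n) s).insert (s' := s') (x := a) (y := b) (by simp) g2 g3
    have hfix : ∀ x y z t u, Fixed G a b k off nbr lab
      (((((((s.setReg 13 x).setReg 24 y).setReg 25 z).setReg 26 t).setMem 2 0 a).setMem 3 0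
        b).setReg 13 u) := fun x y z t u =>
      ((((((hF.setReg _ (by omega)).setReg _ (by omega)).setReg _ (by omega)).setReg _
        (by omega)).setMem _ _ (by omega)).setMem _ _ (by omega)).setReg _ (by omega)
    by_cases hcr : closeness (addEdges G {s(a, b)}) b < closeness (addEdges G {s(a, b)}) a
    · simp only [wp_seq, wp_assign, wp_store, wp_ite, wp_skip, Expr.eval, Expr.cost, Op.apply,
        State.setReg_reg, State.setReg_mem, State.setMem_reg, Nat.reduceEqDiff, reduceIte, c0, c1,
        c2, hF.reg_0, hF.reg_1, hF.reg_2, hF.mem_0, hF.mem_7, hadj, hab', h22, h23, hcr, ne_eq,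
        one_ne_zero, not_false_eq_true, not_true_eq_false, forall_const, IsEmpty.forall_iff,
        and_true, true_and]
      refine ⟨by omega, hfix _ _ _ _ _, .inl ?_⟩
      refine ⟨{s(a, b)}, ∅, .single (.startEnter hab' (not_le.2 hcr)), hst, hW0, ?_,
        not_le.2 hcr, by omega, ?_⟩
      · rw [Finset.card_singleton]
        exact hlist _ (by simp [State.setMem_mem]) (by simp [State.setMem_mem])
      · simp [h22, h23]
    · have hcr' : Crossed G a b {s(a, b)} := not_lt.1 hcr
      have r1 := ratio_of_le (G := addEdges G {s(a, b)}) (a := b) (b := a) hcr'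
      rw [ratio_comm] at r1
      have r2 : ratio (addEdges G ∅) a b = closeness G b / closeness G a := by
        rw [addEdges_empty]; exact ratio_of_le hc.le
      have p1 := closeness_pos hH hab.symm
      have p2 := closeness_pos hG hab
      have m1 := hmul hl1 (hle a)
      have m2 := hmul (hle b) hl2
      by_cases hbt : closeness (addEdges G {s(a, b)}) a * closeness G a <
        closeness G b * closeness (addEdges G {s(a, b)}) b
      · simp only [wp_seq, wp_assign, wp_store, wp_ite, wp_skip, Expr.eval, Expr.cost, Op.apply,
          State.setReg_reg, State.setReg_mem, State.setMem_reg, Nat.reduceEqDiff, reduceIte, c0,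
          c1, c2, hF.reg_0, hF.reg_1, hF.reg_2, hF.mem_0, hF.mem_7, hadj, hab', h22, h23, hcr,
          hF.reg_20, hF.reg_21, m1, m2, hbt, ne_eq, one_ne_zero, not_false_eq_true,
          not_true_eq_false, forall_const, IsEmpty.forall_iff, and_true, true_and]
        refine ⟨by omega, ((hfix _ _ _ _ _).setReg _ (by omega)).setReg _ (by omega), .inr ?_⟩
        refine ⟨by simp, ∅, .single (.startReturn hab' hcr' _ ?_), by simpa using Lists.zero _⟩
        exact isBetterOf_right r1 r2 p1 p2 hbt
      · simp only [wp_seq, wp_assign, wp_store, wp_ite, wp_skip, Expr.eval, Expr.cost, Op.apply,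
          State.setReg_reg, State.setReg_mem, State.setMem_reg, Nat.reduceEqDiff, reduceIte, c0,
          c1, c2, hF.reg_0, hF.reg_1, hF.reg_2, hF.mem_0, hF.mem_7, hadj, hab', h22, h23, hcr,
          hF.reg_20, hF.reg_21, m1, m2, hbt, ne_eq, not_true_eq_false, forall_const,
          IsEmpty.forall_iff, true_and]
        refine ⟨by omega, (hfix _ _ _ _ _).setReg _ (by omega), .inr ?_⟩
        refine ⟨by simp, {s(a, b)}, .single (.startReturn hab' hcr' _ ?_), ?_⟩
        · exact isBetterOf_left r1 r2 p1 p2 hbt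
        · simpa using hlist _ (by simp [State.setMem_mem]) (by simp [State.setMem_mem])

lemma wp_selectLoop {K lab : ℕ → ℕ} {s : State} (hG : G.Connected)
    (hc : closeness G b < closeness G a)
    (hM : n * n * (n * n) < 2 ^ w) (hM2 : 3 ≤ 2 ^ w) (hMk : k < 2 ^ w) (hMo : off n < 2 ^ w)
    (hA : IsAdjacencyArray G off nbr) (hK : Labelled G off nbr b K lab)
    (hF : Fixed G a b k off nbr lab s)
    (hs : AtHead G a b k off nbr 0 s ∨ AtEnd G a b k s) :
    Wp w selectLoop s fun t s' => t ≤ 60 * (off (b + 1) - off b) + 100 ∧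
      ∃ S, Returns G a b k S ∧ Lists s' (s'.reg 13) S := by
  have hab : a ≠ b := by rintro rfl; exact hc.ne rfl
  have c0 : 0 % 2 ^ w = 0 := Nat.zero_mod _
  have c1 : 1 % 2 ^ w = 1 := Nat.mod_eq_of_lt (by omega)
  have c2 : 2 % 2 ^ w = 2 := Nat.mod_eq_of_lt (by omega)
  have hmul : ∀ {x y : ℕ}, x ≤ n * n → y ≤ n * n → x * y % 2 ^ w = x * y := fun hx hy =>
    Nat.mod_eq_of_lt ((Nat.mul_le_mul hx hy).trans_lt hM)
  have hle : ∀ v, closeness G v ≤ n * n := fun v => by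
    simpa using closeness_addEdges_le hG ∅ v
  have hoff : off (b + 1) ≤ off n := hA.listArray.off_le_last b.2
  unfold selectLoop
  refine wp_loop (fun T s' => Fixed G a b k off nbr lab s' ∧
      ((∃ j, AtHead G a b k off nbr j s' ∧ 60 * (off (b + 1) - (off b + j)) + 100 ≤ T) ∨
        (AtEnd G a b k s' ∧ 10 ≤ T))) ?_ ?_ _ s ?_
  · rintro T s' ⟨-, ⟨j, ⟨S, W, -, -, -, -, -, -, -, -, -, h24, -⟩, hT⟩ | ⟨⟨-, h⟩, hT⟩⟩ he
    · simp [Expr.eval, Op.apply, h24] at he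
    · simp only [Expr.cost]
      exact ⟨by omega, h⟩
  · rintro T s' ⟨hF', h⟩ he
    simp only [Expr.eval, Op.apply, c0, ne_eq, ite_eq_right_iff, not_forall] at he
    obtain ⟨he, -⟩ := he
    rcases h with h | ⟨⟨h24, -⟩, -⟩
    swap
    · omega
    obtain ⟨j, ⟨S, W, hR, hS, hW, hL, hnc, hj, h13, h22, h23, h24, h25, h26⟩, hT⟩ := h
    have hH := addEdges_connected hG S
    have pA := closeness_pos hH hab
    have pB := closeness_pos hH hab.symm
    have lA := closeness_addEdges_le hG S a
    have lB := closeness_addEdges_le hG S b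
    have hnc' : closeness (addEdges G S) b ≤ closeness (addEdges G S) a := (not_le.1 hnc).le
    have r1 : ratio (addEdges G S) a b = _ := ratio_of_le hnc'
    by_cases hSk : S.card < k
    · have hjlt : off b + j < off (b + 1) := by
        -- some candidate is not joined to `a` yet, so the list of `b` is not exhausted
        by_contra hge
        obtain ⟨u, h1, h2, h3⟩ := exists_candidate hH (not_le.1 hnc) (hS.adj_ab hab)
        obtain ⟨hu, huW⟩ := (hS.candidate_iff hab u).1 ⟨h1, h2, h3⟩
        obtain ⟨i, i1, i2, i3⟩ := hA.exists_index hu.1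
        exact huW ((hW u).2 ⟨hu, i - off b, by omega, by
          rw [show off b + (i - off b) = i by omega, i3]⟩)
      obtain ⟨u, hbu, hu⟩ := hA.exists_adj (v := b) (i := off b + j) (by omega) hjlt
      have d1 : (off b + j) % 2 ^ w = off b + j := Nat.mod_eq_of_lt (by omega)
      have d2 : (j + 1) % 2 ^ w = j + 1 := Nat.mod_eq_of_lt (by omega)
      have d3 : (S.card + 1) % 2 ^ w = S.card + 1 := Nat.mod_eq_of_lt (by omega)
      have hci := candidate_iff_dist (a := a) hG hbu
      by_cases hcu : Candidate G a b u
      · have hW' := hW.insert hcu hu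
        have hdrop := closeness_insert_add_drop hA hG hab hK hjlt hW hS hcu hW'
        have hS' := hS.insert hcu
        have huW : u ∉ W := by
          rw [hW]
          rintro ⟨-, i, hi, hiu⟩
          have := hA.listArray.nbr_inj b b.2 _ _ (by omega) (by omega) (by omega) hjlt
            (hiu.trans hu.symm)
          omega
        obtain ⟨q1, q2, q3⟩ := (hS.candidate_iff hab u).2 ⟨hcu, huW⟩
        obtain ⟨-, hmem⟩ := hS.notMem_of_not_adj hab q1 q2 q3
        have hcard : (insert s(a, u) S).card = S.card + 1 := Finset.card_insert_of_notMem hmem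
        have hsub : closeness (addEdges G S) a - drop G a b lab j =
          closeness (addEdges G (insert s(a, u) S)) a := by omega
        have hBB : closeness (addEdges G (insert s(a, u) S)) b = closeness (addEdges G S) b := by
          rw [hS.closeness_right hG hab, hS'.closeness_right hG hab]
        have lA' := closeness_addEdges_le hG (insert s(a, u) S) a
        rw [hci] at hcu
        have hlist : ∀ s2 : State, s2.mem 2 = Function.update (s'.mem 2) S.card a →
            s2.mem 3 = Function.update (s'.mem 3) S.card u →
            Lists s2 (S.card + 1) (insert s(a, u) S) := fun s2 g2 g3 => hL.insert hmem g2 g3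
        have hfix : ∀ x y, Fixed G a b k off nbr lab
            (((((s'.setReg 10 u).setMem 2 S.card a).setMem 3 S.card u).setReg 13 x).setReg 30 y) :=
          fun x y => ((((hF'.setReg _ (by omega)).setMem _ _ (by omega)).setMem _ _
            (by omega)).setReg _ (by omega)).setReg _ (by omega)
        by_cases hcr : closeness (addEdges G S) b < closeness (addEdges G (insert s(a, u) S)) a
        · simp only [wp_seq, wp_assign, wp_store, wp_ite, wp_skip, Expr.eval, Expr.cost, Op.apply,
            State.setReg_reg, State.setReg_mem, State.setMem_reg, State.setMem_mem,
            Nat.reduceEqDiff, reduceIte, c1, c2, d1, d2, d3, hF'.reg_0, hF'.reg_1, hF'.reg_3,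
            hF'.mem_1, hF'.mem_7, hF'.mem_9, h13, h22, h23, h25, h26, hu, hcu, hcr, hSk, hsub,
            ne_eq, one_ne_zero, not_false_eq_true, forall_const, IsEmpty.forall_iff, and_true]
          refine ⟨60 * (off (b + 1) - (off b + (j + 1))) + 100, by omega,
            ((hfix _ _).setReg _ (by omega)).setReg _ (by omega), .inl ⟨j + 1, ?_, le_rfl⟩⟩
          have hncr : ¬ Crossed G a b (insert s(a, u) S) := by
            unfold Crossed
            rw [hBB]
            exact not_le.2 hcr
          refine ⟨insert s(a, u) S, insert u W, hR.tail (.loopNext S hSk u q1 q2 q3 hncr), hS', hW',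
            ?_, hncr, by omega, ?_⟩
          · rw [hcard]
            exact hlist _ (by simp [State.setMem_mem]) (by simp [State.setMem_mem])
          · simp [h23, h24, h26, hBB, hcard]
        · have hcr' : Crossed G a b (insert s(a, u) S) := by
            unfold Crossed
            rw [hBB]
            exact not_lt.1 hcr
          have r2 := ratio_of_le (G := addEdges G (insert s(a, u) S)) (a := b) (b := a) hcr'
          rw [ratio_comm, hBB] at r2
          have m1 := hmul lA' lA
          have m2 := hmul lB lB
          have hstep := fun R hR' => hR.tail (Step.loopReturn S hSk u q1 q2 q3 hcr' R hR')
          by_cases hbt : closeness (addEdges G (insert s(a, u) S)) a * closeness (addEdges G S) a <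
            closeness (addEdges G S) b * closeness (addEdges G S) b
          · simp only [wp_seq, wp_assign, wp_store, wp_ite, wp_skip, Expr.eval, Expr.cost, Op.apply,
              State.setReg_reg, State.setReg_mem, State.setMem_reg, State.setMem_mem,
              Nat.reduceEqDiff, reduceIte, c1, c2, d1, d2, d3, hF'.reg_0, hF'.reg_1, hF'.reg_3,
              hF'.mem_1, hF'.mem_7, hF'.mem_9, h13, h22, h23, h25, h26, hu, hcu, hcr, hSk, hsub,
              m1, m2, hbt, ne_eq, one_ne_zero, not_false_eq_true, not_true_eq_false, forall_const,
              IsEmpty.forall_iff, and_true, true_and]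
            refine ⟨10, by omega, ((((hfix _ _).setReg _ (by omega)).setReg _ (by omega)).setReg _
              (by omega)).setReg _ (by omega), .inr ⟨⟨by simp, S, hstep S ?_, ?_⟩, le_rfl⟩⟩
            · exact isBetterOf_right r2 r1 pB pA hbt
            · simp only [State.setReg_reg, Nat.reduceEqDiff, reduceIte, Nat.add_sub_cancel]
              refine hL.congr (fun i hi => ?_) (fun i hi => ?_) <;>
                simp [State.setMem_mem, Function.update_of_ne hi.ne]
          · simp only [wp_seq, wp_assign, wp_store, wp_ite, wp_skip, Expr.eval, Expr.cost, Op.apply,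
              State.setReg_reg, State.setReg_mem, State.setMem_reg, State.setMem_mem,
              Nat.reduceEqDiff, reduceIte, c1, c2, d1, d2, d3, hF'.reg_0, hF'.reg_1, hF'.reg_3,
              hF'.mem_1, hF'.mem_7, hF'.mem_9, h13, h22, h23, h25, h26, hu, hcu, hcr, hSk, hsub,
              m1, m2, hbt, ne_eq, one_ne_zero, not_false_eq_true, not_true_eq_false, forall_const,
              IsEmpty.forall_iff, and_true, true_and]
            refine ⟨10, by omega, (((hfix _ _).setReg _ (by omega)).setReg _ (by omega)).setReg _
              (by omega), .inr ⟨⟨by simp, insert s(a, u) S, hstep _ ?_, ?_⟩, le_rfl⟩⟩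
            · exact isBetterOf_left r2 r1 pB pA hbt
            · simp only [State.setReg_reg, Nat.reduceEqDiff, reduceIte]
              exact hlist _ (by simp [State.setMem_mem]) (by simp [State.setMem_mem])
      · have hW' := hW.skip hcu hu
        rw [hci] at hcu
        simp only [wp_seq, wp_assign, wp_ite, wp_skip, Expr.eval, Expr.cost, Op.apply,
          State.setReg_reg, State.setReg_mem, Nat.reduceEqDiff, reduceIte, c1, c2, d1, d2,
          hF'.reg_0, hF'.reg_3, hF'.mem_1, hF'.mem_7, h13, h25, h26, hu, hcu, hSk, ne_eq,
          one_ne_zero, not_false_eq_true, not_true_eq_false, forall_const, IsEmpty.forall_iff,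
          and_true, true_and]
        refine ⟨60 * (off (b + 1) - (off b + (j + 1))) + 100, by omega,
          (hF'.setReg _ (by omega)).setReg _ (by omega), .inl ⟨j + 1, ?_, le_rfl⟩⟩
        exact ⟨S, W, hR, hS, hW', hL.congr (fun _ _ => rfl) (fun _ _ => rfl), hnc, by omega,
          by simp [h13, h22, h23, h24, h26]⟩
    · have m1 := hmul lB (hle a)
      have m2 := hmul (hle b) lA
      have r2 : ratio (addEdges G ∅) a b = closeness G b / closeness G a := by
        rw [addEdges_empty]; exact ratio_of_le hc.le
      have p2 := closeness_pos hG hab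
      have hstep := fun R hR' => hR.tail (Step.loopExit S hSk R hR')
      by_cases hbt : closeness (addEdges G S) b * closeness G a <
        closeness G b * closeness (addEdges G S) a
      · simp only [wp_seq, wp_assign, wp_ite, wp_skip, Expr.eval, Expr.cost, Op.apply,
          State.setReg_reg, Nat.reduceEqDiff, reduceIte, c0, c1,
          hF'.reg_3, hF'.reg_20, hF'.reg_21, h13, h22, h23, hSk, m1, m2, hbt, ne_eq,
          one_ne_zero, not_false_eq_true, not_true_eq_false, forall_const, IsEmpty.forall_iff,
          and_true, true_and]
        refine ⟨10, by omega, (hF'.setReg _ (by omega)).setReg _ (by omega),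
          .inr ⟨⟨by simp, ∅, hstep _ ?_, by simpa using Lists.zero _⟩, le_rfl⟩⟩
        exact isBetterOf_right r1 r2 pA p2 hbt
      · simp only [wp_seq, wp_assign, wp_ite, wp_skip, Expr.eval, Expr.cost, Op.apply,
          State.setReg_reg, Nat.reduceEqDiff, reduceIte, c1,
          hF'.reg_3, hF'.reg_20, hF'.reg_21, h13, h22, h23, hSk, m1, m2, hbt, ne_eq,
          not_true_eq_false, forall_const, IsEmpty.forall_iff, true_and]
        refine ⟨10, by omega, hF'.setReg _ (by omega),
          .inr ⟨⟨by simp, S, hstep _ ?_, ?_⟩, le_rfl⟩⟩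
        · exact isBetterOf_left r1 r2 pA p2 hbt
        · simp only [State.setReg_reg, Nat.reduceEqDiff, reduceIte, h13]
          exact hL.congr (fun _ _ => rfl) (fun _ _ => rfl)
  · refine ⟨hF, hs.imp (fun h => ⟨0, h, by omega⟩) (fun h => ⟨h, by omega⟩)⟩

end Select

/-! ### The whole program -/

section Main

/-- The algorithm for instances in which `b` has the smaller centrality. The searches fill the
arrays `7` and `8`, which have to be `0` before, as array `9`. -/
def improve : Prog :=
  .assign 4 (.reg 1) ;; bfs 7 ;; .assign 20 (.reg 12) ;;
  .assign 4 (.reg 2) ;; bfs 8 ;; .assign 21 (.reg 12) ;;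
  tally ;; selectInit ;; selectLoop ;; .assign 0 (.reg 13)

/-- Compare the centralities, exchange `a` and `b` if necessary, and run the algorithm. The searches
need arrays filled with `0`; so those after the exchange use new ones. -/
def program : Prog :=
  .assign 4 (.reg 1) ;; bfs 5 ;; .assign 20 (.reg 12) ;;
  .assign 4 (.reg 2) ;; bfs 6 ;; .assign 21 (.reg 12) ;;
  .ite (.bin .eq (.reg 20) (.reg 21)) (.assign 0 (.const 0)) (
    .ite (.bin .lt (.reg 20) (.reg 21)) (
      .assign 4 (.reg 1) ;; .assign 1 (.reg 2) ;; .assign 2 (.reg 4)) .skip ;;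
    improve)

variable {n : ℕ} {G : SimpleGraph (Fin n)} {a b : Fin n} {k : ℕ} {off nbr : ℕ → ℕ} {w : ℕ}

/-- The word length suffices for all numbers that occur: keys and sums of distances are `O(n ^
2)`, and two ratios are compared through products of two centralities. -/
structure Fits (n k : ℕ) (off : ℕ → ℕ) (w : ℕ) : Prop where
  sq : 4 * (n * n) + 8 * n + 8 ≤ 2 ^ w
  fourth : n * n * (n * n) < 2 ^ w
  budget : k < 2 ^ w
  last : off n < 2 ^ w

lemma IsAdjacencyArray.off_last_le (hA : IsAdjacencyArray G off nbr) : off n ≤ n * n := by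
  have : ∀ m ≤ n, off m ≤ m * n := by
    intro m
    induction m with
    | zero => simp [hA.off_zero]
    | succ m ih =>
      intro hm
      have := ih (by omega)
      have := hA.listArray.degree_le (v := m) hm
      rw [Nat.succ_mul]
      omega
  exact this n le_rfl

lemma IsAdjacencyArray.fits (hA : IsAdjacencyArray G off nbr) (hab : a ≠ b) (hk : 1 ≤ k)
    (hw : (n + k) ^ 8 ≤ 2 ^ w) : Fits n k off w := by
  have hn : 2 ≤ n := by
    have := a.2
    have := b.2
    have := Fin.val_ne_of_ne hab
    omega
  have hoff := hA.off_last_le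
  obtain ⟨N, hN⟩ : ∃ N, n + k = N := ⟨_, rfl⟩
  rw [hN] at hw
  have h3 : 3 ≤ N := by omega
  have e1 : N ^ 1 < N ^ 8 := Nat.pow_lt_pow_right (by omega) (by omega)
  have e4 : N ^ 4 < N ^ 8 := Nat.pow_lt_pow_right (by omega) (by omega)
  have hnn : n * n ≤ N * N := Nat.mul_le_mul (by omega) (by omega)
  have h9 : 3 * 3 ≤ N * N := Nat.mul_le_mul h3 h3
  have hNN : 9 * (N * N) ≤ N ^ 4 := by
    have := Nat.mul_le_mul_right (N * N) h9
    calc _ ≤ N * N * (N * N) := this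
      _ = N ^ 4 := by ring
  have hN8 : 81 * N ^ 4 ≤ N ^ 8 := by
    have : 3 ^ 4 ≤ N ^ 4 := Nat.pow_le_pow_left h3 4
    calc 81 * N ^ 4 ≤ N ^ 4 * N ^ 4 := Nat.mul_le_mul_right _ this
      _ = N ^ 8 := by ring
  have h2N : 3 * N ≤ N * N := Nat.mul_le_mul_right _ h3
  refine ⟨by omega, ?_, by rw [pow_one] at e1; omega, by omega⟩
  calc n * n * (n * n) ≤ N * N * (N * N) := Nat.mul_le_mul hnn hnn
    _ = N ^ 4 := by ring
    _ < 2 ^ w := by omega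

/-- The input is in place. -/
structure Ready (n : ℕ) (a b : Fin n) (k : ℕ) (off nbr : ℕ → ℕ) (s : State) : Prop where
  reg_0 : s.reg 0 = n
  reg_1 : s.reg 1 = a
  reg_2 : s.reg 2 = b
  reg_3 : s.reg 3 = k
  mem_0 : s.mem 0 = off
  mem_1 : s.mem 1 = nbr

lemma Ready.setReg {s : State} (h : Ready n a b k off nbr s) {x : ℕ} (v : ℕ) (hx : 4 ≤ x) :
    Ready n a b k off nbr (s.setReg x v) := by
  obtain ⟨h0, h1, h2, h3, m0, m1⟩ := h
  refine ⟨?_, ?_, ?_, ?_, m0, m1⟩ <;> rw [State.setReg_reg, if_neg (by omega)] <;> assumption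

lemma Ready.of_frame {κ : ℕ} {s s' : State} (h : Ready n a b k off nbr s) (hf : BfsFrame κ s s')
    (hκ : 5 ≤ κ) : Ready n a b k off nbr s' := by
  obtain ⟨h0, h1, h2, h3, m0, m1⟩ := h
  refine ⟨?_, ?_, ?_, ?_, ?_, ?_⟩
  iterate 4 (rw [hf.1 _ (by omega)]; assumption)
  all_goals rw [hf.2 _ (by omega) (by omega)]; assumption

lemma Ready.bfsInput {s : State} (h : Ready n a b k off nbr s) (hA : IsAdjacencyArray G off nbr)
    (hfit : Fits n k off w) (r : Fin n) {κ : ℕ} (hκ : 5 ≤ κ) :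
    BfsInput n off nbr r κ w (s.setReg 4 r) where
  list := hA.listArray
  root_lt := r.2
  off_zero := hA.off_zero
  off_lt := hfit.last
  word := hfit.sq
  reg_zero := by simpa using h.reg_0
  reg_four := by simp
  mem_zero := h.mem_0
  mem_one := h.mem_1
  array := hκ

lemma wp_closeness {s : State} (hG : G.Connected) (hA : IsAdjacencyArray G off nbr)
    (hfit : Fits n k off w) (hs : Ready n a b k off nbr s) (r : Fin n) {κ : ℕ} (hκ : 5 ≤ κ)
    (h0 : ∀ v, s.mem κ v = 0) :
    Wp w (bfs κ) (s.setReg 4 r) fun t s' => t ≤ 40 * off n + 200 * (n + 1) ∧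
      Ready n a b k off nbr s' ∧ s'.reg 12 = closeness G r ∧ BfsFrame κ (s.setReg 4 r) s' ∧
      BfsResult n off nbr r (s'.mem κ) ∧ ∃ lab, Labelled G off nbr r (s'.mem κ) lab := by
  refine (wp_bfs (hs.bfsInput hA hfit r hκ) h0).mono ?_
  rintro t s' ⟨h1, h2, h3, h4⟩
  obtain ⟨lab, hlab⟩ := h3.labelled hA hG
  exact ⟨h1, (hs.setReg _ le_rfl).of_frame h2 hκ, h4.trans hlab.sum_eq, h2, h3, lab, hlab⟩

lemma sum_joinDist {K K' lab lab' : ℕ → ℕ}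
    (hK : Labelled G off nbr a K lab) (hK' : Labelled G off nbr b K' lab') :
    ∑ v ∈ Finset.range n, joinDist (K v / n) (K' v / n) = nearSum G a b + closer G b a := by
  classical
  unfold nearSum closer
  rw [Finset.sum_range, Finset.card_filter, ← Finset.sum_add_distrib]
  refine Finset.sum_congr rfl fun v _ => ?_
  rw [hK.div_eq, hK'.div_eq, joinDist]
  split_ifs <;> omega

lemma sum_eq_drop {K K' lab lab' : ℕ → ℕ} (hK : Labelled G off nbr a K lab)
    (hK' : Labelled G off nbr b K' lab') (j : ℕ) :
    (∑ v ∈ Finset.range n, if K' v / n < K v / n ∧ 1 < K' v / n ∧ K' v - K' v / n * n = j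
      then 1 else 0) = drop G a b lab' j := by
  unfold drop
  rw [Finset.sum_range]
  refine Finset.sum_congr rfl fun v _ => ?_
  have h : K' v - K' v / n * n = lab' v := by
    rw [hK'.div_eq, hK'.key, Nat.mul_comm]; omega
  rw [h, hK.div_eq, hK'.div_eq]
  exact if_congr (by omega) rfl rfl

lemma wp_improve {s : State} (hG : G.Connected) (hc : closeness G b < closeness G a)
    (hA : IsAdjacencyArray G off nbr) (hfit : Fits n k off w) (hs : Ready n a b k off nbr s)
    (h7 : ∀ v, s.mem 7 v = 0) (h8 : ∀ v, s.mem 8 v = 0) (h9 : ∀ v, s.mem 9 v = 0) :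
    Wp w improve s fun t s' => t ≤ 140 * off n + 500 * n + 700 ∧
      ∃ S, Returns G a b k S ∧ IsOutput s' S := by
  have hM2 : 3 ≤ 2 ^ w := by have := hfit.sq; omega
  unfold improve
  rw [wp_seq, wp_assign, wp_seq]
  simp only [Expr.eval, Expr.cost, hs.reg_1]
  refine (wp_closeness hG hA hfit hs a (by omega) h7).mono ?_
  rintro t1 s1 ⟨ht1, hs1, hr1, hf1, hB1, lab1, hlab1⟩
  have hs1' := hs1.setReg (s1.reg 12) (x := 20) (by omega)
  rw [wp_seq, wp_assign, wp_seq, wp_assign, wp_seq]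
  simp only [Expr.eval, Expr.cost, hs1'.reg_2]
  have hz : ∀ A, 7 < A → s1.mem A = s.mem A := fun A hA' => hf1.2 A (by omega) (by omega)
  refine (wp_closeness hG hA hfit hs1' b (κ := 8) (by omega) fun v => ?_).mono ?_
  · rw [State.setReg_mem, hz 8 (by omega), h8]
  rintro t2 s2 ⟨ht2, hs2, hr2, hf2, hB2, lab2, hlab2⟩
  have e7 : s2.mem 7 = s1.mem 7 := hf2.2 7 (by omega) (by omega)
  have e9 : s2.mem 9 = s1.mem 9 := hf2.2 9 (by omega) (by omega)
  have e20 : s2.reg 20 = closeness G a := by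
    rw [hf2.1 20 (by omega)]
    simpa using hr1
  have hs2' := hs2.setReg (s2.reg 12) (x := 21) (by omega)
  rw [wp_seq, wp_assign, wp_seq]
  simp only [Expr.eval, Expr.cost]
  rw [← e7] at hB1 hlab1
  refine (wp_tally a.pos hs2'.reg_0 (fun j => ?_) hB1.bound hB2.bound hfit.sq).mono ?_
  · rw [State.setReg_mem, e9, hz 9 (by omega), h9]
  rintro t3 s3 ⟨ht3, hf3, e22, e23, e9'⟩
  have hF : Fixed G a b k off nbr lab2 s3 := by
    have hr : ∀ x, x < 22 → s3.reg x = if x = 21 then s2.reg 12 else s2.reg x := by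
      intro x hx
      rw [hf3.1 x hx, State.setReg_reg]
    refine ⟨?_, ?_, ?_, ?_, ?_, ?_, ?_, ?_, fun v => ?_, fun j => ?_⟩
    · rw [hr 0 (by omega)]; exact hs2.reg_0
    · rw [hr 1 (by omega)]; exact hs2.reg_1
    · rw [hr 2 (by omega)]; exact hs2.reg_2
    · rw [hr 3 (by omega)]; exact hs2.reg_3
    · rw [hr 20 (by omega)]; exact e20
    · rw [hr 21 (by omega)]; exact hr2
    · rw [hf3.2 0 (by omega)]; exact hs2.mem_0
    · rw [hf3.2 1 (by omega)]; exact hs2.mem_1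
    · rw [hf3.2 7 (by omega)]; exact hlab1.div_eq v
    · rw [e9' j]; exact sum_eq_drop hlab1 hlab2 j
  rw [wp_seq]
  refine (wp_selectInit hG hc hfit.fourth hM2 hA hF
    (e22.trans (sum_joinDist hlab1 hlab2)) (e23.trans ?_)).mono ?_
  · rw [nearSum_comm]; exact sum_joinDist hlab2 hlab1
  rintro t4 s4 ⟨ht4, hF4, h4⟩
  rw [wp_seq]
  refine (wp_selectLoop hG hc hfit.fourth hM2 hfit.budget hfit.last hA hlab2 hF4 h4).mono ?_
  rintro t5 s5 ⟨ht5, S, hS, hL⟩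
  rw [wp_assign]
  simp only [Expr.cost, Expr.eval]
  have hlast := hA.listArray.off_le_last (v := b + 1) b.2
  refine ⟨by omega, S, hS, ?_⟩
  simpa [IsOutput, Lists] using hL

lemma isApprox_of_returns (hG : G.Connected) (hk : 1 ≤ k) (hc : closeness G b < closeness G a)
    {S : Finset (Sym2 (Fin n))} (hS : Returns G a b k S) : IsApprox (6 / 11) G a b k S :=
  Reachable.goodConfig hG hk hc hS

lemma isApprox_empty (hG : G.Connected) (hab : a ≠ b) (h : closeness G a = closeness G b) :
    IsApprox (6 / 11) G a b k ∅ := by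
  refine ⟨feasible_empty k, fun T _ => ?_⟩
  have h1 := ratio_le_one (G := addEdges G T) (a := a) (b := b)
  have h2 : (closeness G a : ℚ) ≠ 0 := by exact_mod_cast (closeness_pos hG hab).ne'
  rw [addEdges_empty, ratio_of_le h.ge, ← h, div_self h2]
  linarith

lemma wp_program (hG : G.Connected) (hab : a ≠ b) (hk : 1 ≤ k)
    (hA : IsAdjacencyArray G off nbr) (hfit : Fits n k off w) :
    Wp w program (inputState n a b k off nbr) fun t s' => t ≤ 220 * off n + 900 * n + 1200 ∧
      ∃ S, IsOutput s' S ∧ ReturnsWlog G a b k S ∧ IsApprox (6 / 11) G a b k S := by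
  have hs : Ready n a b k off nbr (inputState n a b k off nbr) := ⟨rfl, rfl, rfl, rfl, rfl, rfl⟩
  have hz : ∀ A, 4 ≤ A → (inputState n a b k off nbr).mem A = fun _ => 0 := by
    intro A hA'
    match A, hA' with
    | A + 4, _ => rfl
  generalize inputState n a b k off nbr = s at hs hz
  unfold program
  rw [wp_seq, wp_assign, wp_seq]
  simp only [Expr.eval, Expr.cost, hs.reg_1]
  refine (wp_closeness hG hA hfit hs a (κ := 5) (by omega) fun v => ?_).mono ?_
  · rw [hz 5 (by omega)]
  rintro t1 s1 ⟨ht1, hs1, hr1, hf1, -, -⟩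
  have hs1' := hs1.setReg (s1.reg 12) (x := 20) (by omega)
  rw [wp_seq, wp_assign, wp_seq, wp_assign, wp_seq]
  simp only [Expr.eval, Expr.cost, hs1'.reg_2]
  have hz1 : ∀ A, 6 ≤ A → s1.mem A = fun _ => 0 := fun A hA' => by
    rw [hf1.2 A (by omega) (by omega)]
    exact hz A (by omega)
  refine (wp_closeness hG hA hfit hs1' b (κ := 6) (by omega) fun v => ?_).mono ?_
  · rw [State.setReg_mem, hz1 6 (by omega)]
  rintro t2 s2 ⟨ht2, hs2, hr2, hf2, -, -⟩
  have hz2 : ∀ A, 7 ≤ A → s2.mem A = fun _ => 0 := fun A hA' => by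
    rw [hf2.2 A (by omega) (by omega)]
    exact hz1 A (by omega)
  have e20 : s2.reg 20 = closeness G a := by
    rw [hf2.1 20 (by omega)]
    simpa using hr1
  have hs2' := hs2.setReg (s2.reg 12) (x := 21) (by omega)
  rw [hr2] at hs2'
  rw [wp_seq, wp_assign, wp_ite]
  simp only [Expr.eval, Expr.cost, Op.apply, State.setReg_reg, Nat.reduceEqDiff, reduceIte, e20,
    hr2, wp_assign, Nat.zero_mod, wp_seq, wp_ite, wp_skip]
  rcases lt_trichotomy (closeness G a) (closeness G b) with hc | hc | hc
  · simp only [hc, hc.ne, reduceIte, ne_eq, one_ne_zero, not_false_eq_true, not_true_eq_false,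
      forall_const, IsEmpty.forall_iff, and_true, true_and]
    refine (wp_improve (a := b) (b := a) hG hc hA hfit ?_ ?_ ?_ ?_).mono ?_
    · refine ⟨?_, ?_, ?_, ?_, hs2.mem_0, hs2.mem_1⟩
      · simpa using hs2.reg_0
      · simpa using hs2.reg_2
      · simpa using hs2.reg_1
      · simpa using hs2.reg_3
    iterate 3 exact fun v => by simp [hz2]
    rintro t s' ⟨ht, S, hS, hO⟩
    exact ⟨by omega, S, hO, .inr (.inl ⟨hc, hS⟩), (isApprox_of_returns hG hk hc hS).symm⟩
  · simp only [hc, reduceIte, ne_eq, one_ne_zero, not_false_eq_true, forall_const,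
      IsEmpty.forall_iff, and_true]
    refine ⟨by omega, ∅, ?_, .inr (.inr ⟨hc, rfl⟩), isApprox_empty hG hab hc⟩
    simp [IsOutput]
  · simp only [hc.ne', hc.not_gt, reduceIte, ne_eq, not_true_eq_false, forall_const,
      IsEmpty.forall_iff, true_and]
    refine (wp_improve hG hc hA hfit hs2' ?_ ?_ ?_).mono ?_
    iterate 3 exact fun v => by simp [hz2]
    rintro t s' ⟨ht, S, hS, hO⟩
    exact ⟨by omega, S, hO, .inl ⟨hc, hS⟩, isApprox_of_returns hG hk hc hS⟩

end Main

end CRI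

theorem theorem4 :
    -- every run of the algorithm terminates, never gets stuck, and returns a 6/11-approximation
    (∀ (V : Type*) [Fintype V] [DecidableEq V] (G : SimpleGraph V) (a b : V) (k : ℕ),
      G.Connected → 1 ≤ k → CRI.closeness G b < CRI.closeness G a →
        Acc (fun c' c => CRI.Step G a b k c c') CRI.Config.start ∧
        (∀ c, CRI.Reachable G a b k c →
          (∃ S, c = CRI.Config.done S) ∨ ∃ c', CRI.Step G a b k c c') ∧
        ∀ S, CRI.Returns G a b k S → CRI.IsApprox (6 / 11) G a b k S) ∧
    -- and it can be carried out on a word RAM in time O((n + m) log k)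
    ∃ (P : CRI.Prog) (C d : ℕ), ∀ (n : ℕ) (G : SimpleGraph (Fin n)) (a b : Fin n) (k : ℕ)
      (off nbr : ℕ → ℕ) (w : ℕ),
      G.Connected → a ≠ b → 1 ≤ k → CRI.IsAdjacencyArray G off nbr → (n + k) ^ d ≤ 2 ^ w →
        ∃ (t : ℕ) (s : CRI.State) (S : Finset (Sym2 (Fin n))),
          CRI.Exec w P (CRI.inputState n a b k off nbr) t s ∧
          t ≤ C * ((n + G.edgeSet.ncard) * (1 + Nat.log 2 k)) ∧
          CRI.IsOutput s S ∧ CRI.ReturnsWlog G a b k S ∧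
          CRI.IsApprox (6 / 11) G a b k S := by
  refine ⟨fun V _ _ G a b k hG hk hc => ⟨CRI.acc_start, fun c h => ?_, fun S hS => ?_⟩,
    CRI.program, 2100, 8, fun n G a b k off nbr w hG hab hk hA hw => ?_⟩
  · exact (h.goodConfig hG hk hc).exists_step hG hc
  · exact CRI.Reachable.goodConfig hG hk hc hS
  · obtain ⟨t, s, hE, ht, S, hO, hR, hS⟩ := CRI.wp_program hG hab hk hA (hA.fits hab hk hw)
    refine ⟨t, s, S, hE, ht.trans ?_, hO, hR, hS⟩
    rw [hA.off_last]
    have hn := a.pos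
    -- `program` takes linear time, so the logarithmic factor is not needed
    calc 220 * (2 * G.edgeSet.ncard) + 900 * n + 1200 ≤ 2100 * (n + G.edgeSet.ncard) := by omega
      _ ≤ 2100 * ((n + G.edgeSet.ncard) * (1 + Nat.log 2 k)) :=
        Nat.mul_le_mul_left _ (Nat.le_mul_of_pos_right _ (by omega))
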